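/- Let $\beta>0$ and $b>0$ (the budget), let $V=\{(v_1,v_2)\in[0,\beta]^2: v_1\ge v_2\}$ be the type space ($v_1$ is the value of the agent, $v_2$ that of the principal), and let $f$ be a probability density on $V$. Let $F_i$ be the marginal distribution function of $v_i$ and $f_i$ its marginal density, i.e. $f_1(x)=\int_0^x f(x,y)\,dy$ and $f_2(x)=\int_x^\beta f(y,x)\,dy$; assume that $f_1,f_2$ are positive and differentiable on $(0,\beta)$. *Choices.* An outcome is a pair $(a,t)\in[0,1]\times\mathbb R$ (allocation probability, payment). For a set $X$ of outcomes let $X_b=\{(a,t)\in X:t\le b\}$ and, for $x\in[0,\beta]$, let $Ch(X;x)$ be the set of maximizers of $xa-t$ over $(a,t)\in X$. Write $X\rhd_x Y$ if $xa-t\ge xa'-t'$ for all $(a,t)\in X$, $(a',t')\in Y$, with strict inequality for at least one pair. For $v\in V$ put $Ch(X;v)=Ch(X;v_2)$ if $Ch(X;v_2)\rhd_{v_1}Ch(X_b;v_1)$, and $Ch(X;v)=Ch(X_b;v_1)$ otherwise. *Mechanisms.* A mechanism is a pair $q:V\to[0,1]$, $p:V\to\mathbb R$, with range $R=\{(q(v),p(v)):v\in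 V\}$. It is incentive compatible (IC) if $(q(v),p(v))\in Ch(R;v)$ for all $v\in V$, and individually rational (IR) if $(0,0)\in R$. Its expected revenue is $\int_V p(v)f(v)\,dv$. A mechanism is optimal if it is IC and IR and its expected revenue is at least that of every IC and IR mechanism (only mechanisms for which $pf$ is integrable on $V$ are considered). A POST-1 mechanism with price $\kappa\in[0,b]$ has $(q(v),p(v))=(0,0)$ if $v_1\le\kappa$ and $(1,\kappa)$ otherwise. A POST-2 mechanism with prices $b\le\kappa_1\le\kappa_2\le\beta$ has $(q(v),p(v))=(0,0)$ if $v_1<\kappa_1$; $=\bigl(1,\,b+\kappa_2(1-\tfrac b{\kappa_1})\bigr)$ if $v_2>\kappa_2$; and $=(\tfrac b{\kappa_1},b)$ otherwise. It is uniform if $\kappa_1=\kappa_2$ and interior if $b<\kappa_1<\kappa_2<\beta$. **Theorem.** Assume that (i) (MLRP) $f_1/f_2$ is nondecreasing on $(0,\beta)$; (ii) $x(1-F_1(x))$ is strictly concave on $[0,\beta]$; (iii) (single crossing) $x-\frac{1-F_2(x)}{f_2(x)}$ crosses zero exactly once on $(0,\beta)$: it is negative before some point of $(0,\beta)$, zero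 there, and positive after it; (iv) the optimal POST-2 mechanism has strictly higher expected revenue than the optimal POST-1 mechanism, i.e. some POST-2 mechanism has strictly higher expected revenue than every POST-1 mechanism. Let $\widetilde\kappa_2$ be the maximizer of $x(1-F_2(x))$ on $[0,\beta]$. 1. If $\frac{f_1(\widetilde\kappa_2)}{f_2(\widetilde\kappa_2)}\le 1$, the optimal mechanism is a uniform POST-2 mechanism: there is a uniform POST-2 mechanism that is optimal among all IC and IR mechanisms, and every POST-2 mechanism that is optimal is uniform. Moreover its common price $\kappa_1=\kappa_2=\kappa^*$ satisfies $\kappa^*\ge\widetilde\kappa_2$ and $$\kappa^* f_2(\kappa^*)-(1-F_2(\kappa^*))=b\bigl(f_2(\kappa^*)-f_1(\kappa^*)\bigr).$$ 2. If $\frac{f_1(\widetilde\kappa_2)}{f_2(\widetilde\kappa_2)}>1$, the optimal mechanism is an interior POST-2 mechanism: there is an interior POST-2 mechanism that is optimal among all IC and IR mechanisms, and every POST-2 mechanism that is optimal is interior. -/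

import Mathlib

open Set MeasureTheory

namespace BudgetSale

/-- The type space: pairs `(v₁, v₂)` in `[0, β]²` with `v₁ ≥ v₂`
(agent's value first, principal's value second). -/
def typeSpace (β : ℝ) : Set (ℝ × ℝ) :=
  {v | v.1 ∈ Icc 0 β ∧ v.2 ∈ Icc 0 β ∧ v.2 ≤ v.1}

/-! ### Choices. An outcome is a pair `(a, t)`: allocation probability and payment. -/

/-- Quasilinear utility of an outcome `z = (a, t)` at the valuation `x`. -/
def utility (x : ℝ) (z : ℝ × ℝ) : ℝ := x * z.1 - z.2

/-- The choice set `Ch(X; x)` at a single valuation `x`: the best outcomes of the menu `X`. -/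
def bestChoices (X : Set (ℝ × ℝ)) (x : ℝ) : Set (ℝ × ℝ) :=
  {z | z ∈ X ∧ ∀ z' ∈ X, utility x z' ≤ utility x z}

/-- The outcomes of the menu `X` which the agent can afford, `X_b`. -/
def budgetSet (b : ℝ) (X : Set (ℝ × ℝ)) : Set (ℝ × ℝ) := {z | z ∈ X ∧ z.2 ≤ b}

/-- Every outcome in `X` is at least as good as every outcome in `Y`, at valuation `x`. -/
def WeaklyPreferred (x : ℝ) (X Y : Set (ℝ × ℝ)) : Prop :=
  ∀ z ∈ X, ∀ z' ∈ Y, utility x z' ≤ utility x z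

/-- `X` is weakly preferred to `Y`, with a strict inequality for at least one pair. -/
def StrictlyPreferred (x : ℝ) (X Y : Set (ℝ × ℝ)) : Prop :=
  WeaklyPreferred x X Y ∧ ∃ z ∈ X, ∃ z' ∈ Y, utility x z' < utility x z

open Classical in
/-- The choice of the principal-agent pair of type `v` from the menu `X`. -/
noncomputable def pairChoice (b : ℝ) (X : Set (ℝ × ℝ)) (v : ℝ × ℝ) : Set (ℝ × ℝ) :=
  if StrictlyPreferred v.1 (bestChoices X v.2) (bestChoices (budgetSet b X) v.1) then
    bestChoices X v.2
  else
    bestChoices (budgetSet b X) v.1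

/-! ### Mechanisms -/

/-- A (direct) mechanism: allocation rule `q` with values in `[0, 1]` and payment rule `p`.
Only the values of `q` and `p` on the type space are ever used. -/
structure Mechanism (β : ℝ) where
  q : ℝ × ℝ → ℝ
  p : ℝ × ℝ → ℝ
  q_mem : ∀ v ∈ typeSpace β, q v ∈ Icc (0 : ℝ) 1

/-- The range of the mechanism. -/
def Mechanism.menu {β : ℝ} (M : Mechanism β) : Set (ℝ × ℝ) :=
  (fun v => (M.q v, M.p v)) '' typeSpace β

/-- Incentive compatibility with budget `b`. -/
def Mechanism.IC {β : ℝ} (b : ℝ) (M : Mechanism β) : Prop :=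
  ∀ v ∈ typeSpace β, (M.q v, M.p v) ∈ pairChoice b M.menu v

/-- Individual rationality. -/
def Mechanism.IR {β : ℝ} (M : Mechanism β) : Prop := ((0 : ℝ), (0 : ℝ)) ∈ M.menu

/-- The expected revenue integral is meaningful. -/
def Mechanism.HasRevenue {β : ℝ} (f : ℝ × ℝ → ℝ) (M : Mechanism β) : Prop :=
  IntegrableOn (fun v => M.p v * f v) (typeSpace β)

/-- Expected revenue under the joint density `f`. -/
noncomputable def Mechanism.revenue {β : ℝ} (f : ℝ × ℝ → ℝ) (M : Mechanism β) : ℝ :=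
  ∫ v in typeSpace β, M.p v * f v

/-- An optimal mechanism: it maximizes expected revenue among all IC and IR mechanisms
(whose expected revenue is defined). -/
def Mechanism.IsOptimal {β : ℝ} (b : ℝ) (f : ℝ × ℝ → ℝ) (M : Mechanism β) : Prop :=
  M.IC b ∧ M.IR ∧ M.HasRevenue f ∧
    ∀ N : Mechanism β, N.IC b → N.IR → N.HasRevenue f → N.revenue f ≤ M.revenue f

/-- `M` is the POST-1 mechanism with price `κ ∈ [0, b]`. -/
def Mechanism.IsPost1 {β : ℝ} (b κ : ℝ) (M : Mechanism β) : Prop :=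
  κ ∈ Icc 0 b ∧ ∀ v ∈ typeSpace β,
    (M.q v, M.p v) = if v.1 ≤ κ then (0, 0) else (1, κ)

/-- `M` is the POST-2 mechanism with prices `b ≤ κ₁ ≤ κ₂ ≤ β`. -/
def Mechanism.IsPost2 {β : ℝ} (b κ₁ κ₂ : ℝ) (M : Mechanism β) : Prop :=
  b ≤ κ₁ ∧ κ₁ ≤ κ₂ ∧ κ₂ ≤ β ∧ ∀ v ∈ typeSpace β,
    (M.q v, M.p v) =
      if v.1 < κ₁ then (0, 0)
      else if κ₂ < v.2 then (1, b + κ₂ * (1 - b / κ₁))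
      else (b / κ₁, b)

/-- The POST-2 mechanism with prices `κ₁, κ₂` is uniform. -/
def Mechanism.IsUniformPost2 {β : ℝ} (b κ₁ κ₂ : ℝ) (M : Mechanism β) : Prop :=
  M.IsPost2 b κ₁ κ₂ ∧ κ₁ = κ₂

/-- The POST-2 mechanism with prices `κ₁, κ₂` is interior. -/
def Mechanism.IsInteriorPost2 {β : ℝ} (b κ₁ κ₂ : ℝ) (M : Mechanism β) : Prop :=
  M.IsPost2 b κ₁ κ₂ ∧ b < κ₁ ∧ κ₁ < κ₂ ∧ κ₂ < β

/-! ### The prior -/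

/-- `f` is a probability density on the type space. -/
structure IsJointDensity (β : ℝ) (f : ℝ × ℝ → ℝ) : Prop where
  nonneg : ∀ v ∈ typeSpace β, 0 ≤ f v
  integrable : IntegrableOn f (typeSpace β)
  total : ∫ v in typeSpace β, f v = 1

/-- Marginal distribution function `F₁` of the agent's value. -/
noncomputable def cdf₁ (β : ℝ) (f : ℝ × ℝ → ℝ) (x : ℝ) : ℝ :=
  ∫ v in typeSpace β ∩ {v | v.1 ≤ x}, f v

/-- Marginal distribution function `F₂` of the principal's value. -/
noncomputable def cdf₂ (β : ℝ) (f : ℝ × ℝ → ℝ) (x : ℝ) : ℝ :=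
  ∫ v in typeSpace β ∩ {v | v.2 ≤ x}, f v

/-- Marginal density `f₁` of the agent's value: given `v₁ = x`, `v₂` ranges over `[0, x]`. -/
noncomputable def density₁ (f : ℝ × ℝ → ℝ) (x : ℝ) : ℝ :=
  ∫ y in Icc 0 x, f (x, y)

/-- Marginal density `f₂` of the principal's value: given `v₂ = x`, `v₁` ranges over `[x, β]`. -/
noncomputable def density₂ (β : ℝ) (f : ℝ × ℝ → ℝ) (x : ℝ) : ℝ :=
  ∫ y in Icc x β, f (y, x)

/-- The monotone likelihood ratio property: `f₁ / f₂` is increasing. -/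
def MLRP (β : ℝ) (f : ℝ × ℝ → ℝ) : Prop :=
  MonotoneOn (fun x => density₁ f x / density₂ β f x) (Ioo 0 β)

/-- Single crossing for `F₂`: the function `x - (1 - F₂ x) / f₂ x` crosses zero exactly once. -/
def SingleCrossing (β : ℝ) (f : ℝ × ℝ → ℝ) : Prop :=
  ∃ c ∈ Ioo 0 β,
    (∀ x ∈ Ioo 0 c, x - (1 - cdf₂ β f x) / density₂ β f x < 0) ∧
    c - (1 - cdf₂ β f c) / density₂ β f c = 0 ∧
    (∀ x ∈ Ioo c β, 0 < x - (1 - cdf₂ β f x) / density₂ β f x)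

/-- The optimal POST-2 mechanism earns strictly more than the optimal POST-1 mechanism, that is,
some POST-2 mechanism earns strictly more than every POST-1 mechanism. -/
def Post2BeatsPost1 (β b : ℝ) (f : ℝ × ℝ → ℝ) : Prop :=
  ∃ (M : Mechanism β) (κ₁ κ₂ : ℝ), M.IsPost2 b κ₁ κ₂ ∧
    ∀ (N : Mechanism β) (κ : ℝ), N.IsPost1 b κ → N.revenue f < M.revenue f

end BudgetSale

open BudgetSale

/-! Two-dimensional screening is reduced to two one-dimensional problems. Let `X` be the range of an
IC and IR mechanism, and let U and u be the indirect utilities of `X` and of its affordable part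
`X_b`; both are convex. Let κ be the last valuation with U = u (`exists_threshold`). A principal
below κ never induces an unaffordable purchase, so the payment there is at most the u-payment at v₁
and at most b. A principal above κ causes a payment of at most the U-payment at v₂, which is at
least b. Off the null set v₂ = κ the payment is therefore bounded by a function of v₁ plus a
function of v₂, and only the two marginals matter (`revenue_le_integral`).

Each one-dimensional payment is x·U' − U. Integration by parts turns revenue into boundary terms
minus ∫ U'·R', where R(x) = x(1 − F(x)). Below κ, concavity of R₁ makes a step allocation 0, a best
for a given utility gain (`integral_payment_le_of_concave`). Above κ, allocations are at least a,
and single-peakedness of R₂ makes the step a, 1 best (`integral_payment_le_of_singlePeaked`). With a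
= (b + u(κ))/κ the boundary terms at κ cancel and a POST-2 revenue remains; if this a exceeds 1,
then κ = β and a single price remains (`revenue_le`).

It remains to maximize b(1 − F₁(κ₁)) + (1 − b/κ₁)R₂(κ₂) over b ≤ κ₁ ≤ κ₂ ≤ β. A maximizer exists by
compactness, beating POST-1 forces b < κ₁ < β, and single-peakedness gives κ₂ = max(κ₁, k₂), with k₂
the peak of R₂. The first-order conditions `foc_of_lt` and `foc_of_eq`, combined with MLRP, exclude
κ₁ < k₂ when f₁/f₂ ≤ 1 at k₂, and κ₁ ≥ k₂ when it exceeds 1. -/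

namespace BudgetSale

/-! ### The indirect utility of a menu -/

/-- A nonempty menu of outcomes with payments bounded below. -/
structure IsMenu (X : Set (ℝ × ℝ)) : Prop where
  nonempty : X.Nonempty
  alloc_mem : ∀ z ∈ X, z.1 ∈ Icc (0 : ℝ) 1
  payment_bdd : ∃ C, ∀ z ∈ X, C ≤ z.2

/-- Indirect utility of the menu `X` at the valuation `x`. -/
noncomputable def menuValue (X : Set (ℝ × ℝ)) (x : ℝ) : ℝ := sSup (utility x '' X)

/-- The largest allocation compatible with the indirect utility: its right derivative. -/
noncomputable def menuSlope (X : Set (ℝ × ℝ)) (x : ℝ) : ℝ :=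
  derivWithin (menuValue X) (Ioi x) x

/-- The largest payment compatible with the indirect utility. -/
noncomputable def menuPayment (X : Set (ℝ × ℝ)) (x : ℝ) : ℝ :=
  x * menuSlope X x - menuValue X x

namespace IsMenu

variable {X Y : Set (ℝ × ℝ)} {x y b m : ℝ} {z : ℝ × ℝ}

theorem bddAbove (hX : IsMenu X) (x : ℝ) : BddAbove (utility x '' X) := by
  obtain ⟨C, hC⟩ := hX.payment_bdd
  refine ⟨|x| - C, ?_⟩
  rintro _ ⟨z, hz, rfl⟩
  have h1 := hX.alloc_mem z hz
  have h2 : x * z.1 ≤ |x| * 1 :=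
    (mul_le_mul_of_nonneg_right (le_abs_self x) h1.1).trans
      (mul_le_mul_of_nonneg_left h1.2 (abs_nonneg x))
  have := hC z hz
  simp only [utility]
  linarith

theorem utility_le (hX : IsMenu X) (hz : z ∈ X) (x : ℝ) : utility x z ≤ menuValue X x :=
  le_csSup (hX.bddAbove x) (mem_image_of_mem _ hz)

theorem value_le (hX : IsMenu X) (h : ∀ z ∈ X, utility x z ≤ m) : menuValue X x ≤ m := by
  refine csSup_le (hX.nonempty.image _) ?_
  rintro _ ⟨z, hz, rfl⟩
  exact h z hz

theorem exists_lt_utility (hX : IsMenu X) (h : m < menuValue X x) : ∃ z ∈ X, m < utility x z := by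
  obtain ⟨_, ⟨z, hz, rfl⟩, h'⟩ := exists_lt_of_lt_csSup (hX.nonempty.image _) h
  exact ⟨z, hz, h'⟩

theorem value_mono (hX : IsMenu X) (hY : IsMenu Y) (h : X ⊆ Y) (x : ℝ) :
    menuValue X x ≤ menuValue Y x :=
  hX.value_le fun _ hz => hY.utility_le (h hz) x

theorem value_eq (hX : IsMenu X) (hz : z ∈ bestChoices X x) : menuValue X x = utility x z :=
  le_antisymm (hX.value_le hz.2) (hX.utility_le hz.1 x)

theorem convexOn (hX : IsMenu X) : ConvexOn ℝ univ (menuValue X) := by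
  refine ⟨convex_univ, fun x _ y _ s t hs ht hst => hX.value_le fun z hz => ?_⟩
  have h1 := mul_le_mul_of_nonneg_left (hX.utility_le hz x) hs
  have h2 := mul_le_mul_of_nonneg_left (hX.utility_le hz y) ht
  simp only [utility, smul_eq_mul] at *
  have : z.2 = s * z.2 + t * z.2 := by rw [← add_mul, hst, one_mul]
  linarith

theorem hasDerivWithinAt (hX : IsMenu X) (x : ℝ) :
    HasDerivWithinAt (menuValue X) (menuSlope X x) (Ioi x) x :=
  hX.convexOn.hasDerivWithinAt_rightDeriv_of_mem_interior (by simp)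

theorem continuous (hX : IsMenu X) : Continuous (menuValue X) :=
  hX.convexOn.locallyLipschitz.continuous

theorem slope_mono (hX : IsMenu X) : Monotone (menuSlope X) := by
  have := hX.convexOn.monotoneOn_rightDeriv
  rwa [interior_univ, monotoneOn_univ] at this

theorem le_slope (hX : IsMenu X) (h : ∀ y, x < y → m * (y - x) ≤ menuValue X y - menuValue X x) :
    m ≤ menuSlope X x := by
  refine ge_of_tendsto
    ((hasDerivWithinAt_iff_tendsto_slope' self_notMem_Ioi).mp (hX.hasDerivWithinAt x)) ?_
  filter_upwards [self_mem_nhdsWithin] with y hy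
  rw [slope_def_field, le_div_iff₀ (sub_pos.2 hy)]
  exact h y hy

theorem slope_le (hX : IsMenu X) (h : ∀ y, x < y → menuValue X y - menuValue X x ≤ m * (y - x)) :
    menuSlope X x ≤ m := by
  refine le_of_tendsto
    ((hasDerivWithinAt_iff_tendsto_slope' self_notMem_Ioi).mp (hX.hasDerivWithinAt x)) ?_
  filter_upwards [self_mem_nhdsWithin] with y hy
  rw [slope_def_field, div_le_iff₀ (sub_pos.2 hy)]
  exact h y hy

theorem slope_nonneg (hX : IsMenu X) (x : ℝ) : 0 ≤ menuSlope X x := by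
  refine hX.le_slope fun y hxy => ?_
  have : menuValue X x ≤ menuValue X y := hX.value_le fun z hz => by
    have h1 := hX.utility_le hz y
    have h2 := mul_le_mul_of_nonneg_right hxy.le (hX.alloc_mem z hz).1
    simp only [utility] at *
    linarith
  linarith

theorem value_sub_le (hX : IsMenu X) (hxy : x ≤ y) (hm : ∀ z ∈ X, z.1 ≤ m) :
    menuValue X y - menuValue X x ≤ m * (y - x) := by
  have : menuValue X y ≤ menuValue X x + m * (y - x) := hX.value_le fun z hz => by
    have h1 := hX.utility_le hz x
    have h2 := mul_le_mul_of_nonneg_right (hm z hz) (sub_nonneg.2 hxy)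
    simp only [utility] at *
    linarith
  linarith

theorem slope_le_of_alloc_le (hX : IsMenu X) (hm : ∀ z ∈ X, z.1 ≤ m) (x : ℝ) :
    menuSlope X x ≤ m :=
  hX.slope_le fun _ hxy => hX.value_sub_le hxy.le hm

theorem slope_le_one (hX : IsMenu X) (x : ℝ) : menuSlope X x ≤ 1 :=
  hX.slope_le_of_alloc_le (fun z hz => (hX.alloc_mem z hz).2) x

theorem subgradient (hX : IsMenu X) (x y : ℝ) :
    menuValue X x + menuSlope X x * (y - x) ≤ menuValue X y := by
  rcases lt_trichotomy x y with h | rfl | h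
  · have := hX.convexOn.rightDeriv_le_slope_of_mem_interior (x := x) (y := y) (by simp) (by simp) h
    rw [slope_def_field, le_div_iff₀ (sub_pos.2 h)] at this
    unfold menuSlope
    linarith
  · simp
  · have h1 := hX.convexOn.slope_le_leftDeriv_of_mem_interior (x := y) (y := x)
      (by simp) (by simp) h
    have h2 := h1.trans (hX.convexOn.leftDeriv_le_rightDeriv_of_mem_interior (by simp))
    rw [slope_def_field, div_le_iff₀ (sub_pos.2 h)] at h2
    unfold menuSlope
    linarith

theorem alloc_le_slope (hX : IsMenu X) (hz : z ∈ bestChoices X x) : z.1 ≤ menuSlope X x := by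
  refine hX.le_slope fun y _ => ?_
  have := hX.utility_le hz.1 y
  rw [hX.value_eq hz]
  simp only [utility] at *
  linarith

theorem payment_le (hX : IsMenu X) (hx : 0 ≤ x) (hz : z ∈ bestChoices X x) :
    z.2 ≤ menuPayment X x := by
  have h := mul_le_mul_of_nonneg_left (hX.alloc_le_slope hz) hx
  have h' := hX.value_eq hz
  simp only [utility, menuPayment] at *
  linarith

/-- Each utility line has intercept at least −b at 0 and lies below the indirect utility at x.
Beyond x it therefore stays below the line through (0, −b) and (x, `menuValue X x`), whose slope
bounds the right derivative. -/
theorem menuPayment_le (hX : IsMenu X) (hx : 0 < x) (hb : ∀ z ∈ X, z.2 ≤ b) :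
    menuPayment X x ≤ b := by
  have : menuSlope X x ≤ (b + menuValue X x) / x := by
    refine hX.slope_le fun y hxy => ?_
    rw [div_mul_eq_mul_div, le_div_iff₀ hx]
    have h : menuValue X y ≤ (b * (y - x) + y * menuValue X x) / x := by
      refine hX.value_le fun z hz => ?_
      rw [le_div_iff₀ hx]
      have h1 := mul_le_mul_of_nonneg_left (hX.utility_le hz x) (hx.trans hxy).le
      have h2 := mul_le_mul_of_nonneg_right (hb z hz) (sub_nonneg.2 hxy.le)
      simp only [utility] at *
      linarith
    rw [le_div_iff₀ hx] at h
    linarith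
  rw [le_div_iff₀ hx] at this
  unfold menuPayment
  linarith

/-- If near-optimal outcomes at `x` cost at least `b`, so does the payment `menuPayment X x`. -/
theorem le_menuPayment (hX : IsMenu X) (hx : 0 < x) (hm : m < menuValue X x)
    (hb : ∀ z ∈ X, m < utility x z → b ≤ z.2) : b ≤ menuPayment X x := by
  have : (b + menuValue X x) / x ≤ menuSlope X x := by
    refine hX.le_slope fun y hxy => ?_
    rw [div_mul_eq_mul_div, div_le_iff₀ hx]
    -- The supremum at x need not be attained, so a near-optimal outcome is used; its error ε/y
    -- becomes ε after scaling by y.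
    refine le_of_forall_pos_le_add fun ε hε => ?_
    have hy : 0 < y := hx.trans hxy
    obtain ⟨z, hz, hlt⟩ := hX.exists_lt_utility
      (max_lt hm (sub_lt_self (menuValue X x) (div_pos hε hy)))
    have hlt1 := (le_max_left _ _).trans_lt hlt
    have hlt2 := (le_max_right _ _).trans_lt hlt
    have h1 := mul_le_mul_of_nonneg_right (hb z hz hlt1) (sub_nonneg.2 hxy.le)
    have h2 := mul_le_mul_of_nonneg_left (hX.utility_le hz y) hx.le
    have h3 := mul_le_mul_of_nonneg_left hlt2.le hy.le
    have h4 : y * (ε / y) = ε := by field_simp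
    rw [mul_sub, h4] at h3
    simp only [utility] at *
    linarith
  rw [div_le_iff₀ hx] at this
  unfold menuPayment
  linarith

theorem measurable_slope (hX : IsMenu X) : Measurable (menuSlope X) := hX.slope_mono.measurable

theorem measurable_payment (hX : IsMenu X) : Measurable (menuPayment X) :=
  (measurable_id.mul hX.measurable_slope).sub hX.continuous.measurable

theorem exists_abs_payment_le (hX : IsMenu X) (β : ℝ) :
    ∃ C, ∀ x ∈ Icc 0 β, |menuPayment X x| ≤ C := by
  obtain ⟨C, hC⟩ := isCompact_Icc.exists_bound_of_continuousOn
    (hX.continuous.continuousOn (s := Icc 0 β))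
  refine ⟨β + C, fun x hx => ?_⟩
  have h1 := hC x hx
  rw [Real.norm_eq_abs, abs_le] at h1
  have h2 := mul_nonneg hx.1 (hX.slope_nonneg x)
  have h3 := mul_le_mul_of_nonneg_left (hX.slope_le_one x) hx.1
  have := hx.2
  unfold menuPayment
  rw [abs_le]
  constructor <;> linarith

end IsMenu

end BudgetSale

namespace BudgetSale

/-! ### Marginal distributions -/

/-- `F` is a distribution function on `[0, β]` with density `g`, continuous in the interior. -/
structure IsMarginal (β : ℝ) (F g : ℝ → ℝ) : Prop where
  pos : 0 < β
  integrable : IntegrableOn g (Icc 0 β)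
  nonneg : ∀ x ∈ Icc 0 β, 0 ≤ g x
  zero : F 0 = 0
  top : F β = 1
  continuousOn : ContinuousOn F (Icc 0 β)
  hasDerivAt : ∀ x ∈ Ioo 0 β, HasDerivAt F (g x) x
  integral : ∀ x ∈ Icc 0 β, ∀ y ∈ Icc 0 β, ∫ t in x..y, g t = F y - F x

variable {β : ℝ} {f : ℝ × ℝ → ℝ} {F g h : ℝ → ℝ}

theorem IsMarginal.of_primitive (hβ : 0 < β) (hg : IntegrableOn g (Icc 0 β))
    (hnn : ∀ x ∈ Icc 0 β, 0 ≤ g x) (hc : ContinuousOn g (Ioo 0 β))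
    (hF : ∀ x ∈ Icc 0 β, F x = ∫ t in (0 : ℝ)..x, g t) (htop : F β = 1) :
    IsMarginal β F g := by
  have hint : ∀ x ∈ Icc 0 β, ∀ y ∈ Icc 0 β, IntervalIntegrable g volume x y := fun x hx y hy =>
    (hg.mono_set (ordConnected_Icc.uIcc_subset hx hy)).intervalIntegrable
  have h0 : (0 : ℝ) ∈ Icc 0 β := ⟨le_rfl, hβ.le⟩
  refine ⟨hβ, hg, hnn, by simp [hF 0 h0], htop, ?_, fun x hx => ?_, fun x hx y hy => ?_⟩
  · have := intervalIntegral.continuousOn_primitive_interval (a := 0) (b := β) (f := g)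
      (μ := volume) (by rwa [uIcc_of_le hβ.le])
    rw [uIcc_of_le hβ.le] at this
    exact this.congr hF
  · have := intervalIntegral.integral_hasDerivAt_right (hint 0 h0 x (Ioo_subset_Icc_self hx))
      (hc.stronglyMeasurableAtFilter isOpen_Ioo x hx) (hc.continuousAt (isOpen_Ioo.mem_nhds hx))
    refine this.congr_of_eventuallyEq ?_
    filter_upwards [isOpen_Ioo.mem_nhds hx] with y hy using hF y (Ioo_subset_Icc_self hy)
  · rw [hF x hx, hF y hy, intervalIntegral.integral_interval_sub_left (hint 0 h0 y hy)
      (hint 0 h0 x hx)]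

namespace IsMarginal

theorem mono (hF : IsMarginal β F g) : MonotoneOn F (Icc 0 β) := fun x hx y hy hxy => by
  have := hF.integral x hx y hy
  have h2 : 0 ≤ ∫ t in x..y, g t := intervalIntegral.integral_nonneg hxy fun t ht =>
    hF.nonneg t ⟨hx.1.trans ht.1, ht.2.trans hy.2⟩
  linarith

theorem le_one (hF : IsMarginal β F g) {x : ℝ} (hx : x ∈ Icc 0 β) : F x ≤ 1 := by
  rw [← hF.top]
  exact hF.mono hx ⟨hF.pos.le, le_rfl⟩ hx.2

theorem cdf_nonneg (hF : IsMarginal β F g) {x : ℝ} (hx : x ∈ Icc 0 β) : 0 ≤ F x := by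
  rw [← hF.zero]
  exact hF.mono ⟨le_rfl, hF.pos.le⟩ hx hx.1

theorem integrableOn_mul (hF : IsMarginal β F g) (hh : Measurable h)
    (hb : ∃ C, ∀ x ∈ Icc 0 β, |h x| ≤ C) : IntegrableOn (fun x => h x * g x) (Icc 0 β) := by
  obtain ⟨C, hC⟩ := hb
  exact hF.integrable.bdd_mul hh.aestronglyMeasurable
    ((ae_restrict_iff' measurableSet_Icc).2 (.of_forall hC))

/-- Revenue of the posted price `x` for one unit. -/
theorem hasDerivAt_price (hF : IsMarginal β F g) {x : ℝ} (hx : x ∈ Ioo 0 β) :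
    HasDerivAt (fun x => x * (1 - F x)) (1 - F x - x * g x) x := by
  have := (hasDerivAt_id x).mul ((hF.hasDerivAt x hx).const_sub 1)
  refine this.congr_deriv ?_
  simp
  ring

theorem continuousOn_price (hF : IsMarginal β F g) :
    ContinuousOn (fun x => x * (1 - F x)) (Icc 0 β) :=
  continuousOn_id.mul (continuousOn_const.sub hF.continuousOn)

end IsMarginal

/-! ### Reduction from the joint density to its marginals -/

theorem measurableSet_typeSpace (β : ℝ) : MeasurableSet (typeSpace β) :=
  (measurable_fst measurableSet_Icc).inter ((measurable_snd measurableSet_Icc).inter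
    (measurableSet_le measurable_snd measurable_fst))

/-- Fubini: the slice of the triangle at v₁ = x is [0, x], exactly the domain of integration in
`density₁`. The weight `h` is general so that both payments and indicators (for the distribution
function) are covered. -/
theorem setIntegral_mul_fst
    (hi : IntegrableOn (fun v : ℝ × ℝ => h v.1 * f v) (typeSpace β)) :
    ∫ v in typeSpace β, h v.1 * f v = ∫ x in Icc 0 β, h x * density₁ f x := by
  have hT := measurableSet_typeSpace β
  rw [← integral_indicator hT, ← integral_indicator measurableSet_Icc, Measure.volume_eq_prod,
    integral_prod _ ((integrable_indicator_iff hT).2 hi)]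
  congr 1 with x
  by_cases hx : x ∈ Icc 0 β
  · rw [indicator_of_mem hx, density₁, ← integral_const_mul, ← integral_indicator measurableSet_Icc]
    congr 1 with y
    by_cases hy : y ∈ Icc 0 x
    · rw [indicator_of_mem hy,
        indicator_of_mem (show (x, y) ∈ typeSpace β from ⟨hx, ⟨hy.1, hy.2.trans hx.2⟩, hy.2⟩)]
    · rw [indicator_of_notMem hy, indicator_of_notMem fun hv => hy ⟨hv.2.1.1, hv.2.2⟩]
  · rw [indicator_of_notMem hx]
    refine integral_eq_zero_of_ae (.of_forall fun y => ?_)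
    exact indicator_of_notMem (fun hv => hx hv.1) _

theorem setIntegral_mul_snd
    (hi : IntegrableOn (fun v : ℝ × ℝ => h v.2 * f v) (typeSpace β)) :
    ∫ v in typeSpace β, h v.2 * f v = ∫ x in Icc 0 β, h x * density₂ β f x := by
  have hT := measurableSet_typeSpace β
  rw [← integral_indicator hT, ← integral_indicator measurableSet_Icc, Measure.volume_eq_prod,
    integral_prod_symm _ ((integrable_indicator_iff hT).2 hi)]
  congr 1 with y
  by_cases hy : y ∈ Icc 0 β
  · rw [indicator_of_mem hy, density₂, ← integral_const_mul, ← integral_indicator measurableSet_Icc]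
    congr 1 with x
    by_cases hx : x ∈ Icc y β
    · rw [indicator_of_mem hx,
        indicator_of_mem (show (x, y) ∈ typeSpace β from ⟨⟨hy.1.trans hx.1, hx.2⟩, hy, hx.1⟩)]
    · rw [indicator_of_notMem hx, indicator_of_notMem fun hv => hx ⟨hv.2.2, hv.1.2⟩]
  · rw [indicator_of_notMem hy]
    refine integral_eq_zero_of_ae (.of_forall fun x => ?_)
    exact indicator_of_notMem (fun hv => hy hv.2.1) _

namespace IsJointDensity

theorem integrableOn_mul (hf : IsJointDensity β f) {φ : ℝ × ℝ → ℝ} (hφ : Measurable φ)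
    (hb : ∃ C, ∀ v ∈ typeSpace β, |φ v| ≤ C) :
    IntegrableOn (fun v => φ v * f v) (typeSpace β) := by
  obtain ⟨C, hC⟩ := hb
  exact hf.integrable.bdd_mul hφ.aestronglyMeasurable
    ((ae_restrict_iff' (measurableSet_typeSpace β)).2 (.of_forall hC))

theorem integrableOn_mul_fst (hf : IsJointDensity β f) (hh : Measurable h)
    (hb : ∃ C, ∀ x ∈ Icc 0 β, |h x| ≤ C) :
    IntegrableOn (fun v : ℝ × ℝ => h v.1 * f v) (typeSpace β) :=
  hf.integrableOn_mul (hh.comp measurable_fst) (hb.imp fun _ hC v hv => hC v.1 hv.1)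

theorem integrableOn_mul_snd (hf : IsJointDensity β f) (hh : Measurable h)
    (hb : ∃ C, ∀ x ∈ Icc 0 β, |h x| ≤ C) :
    IntegrableOn (fun v : ℝ × ℝ => h v.2 * f v) (typeSpace β) :=
  hf.integrableOn_mul (hh.comp measurable_snd) (hb.imp fun _ hC v hv => hC v.2 hv.2.1)

theorem integrable_indicator (hf : IsJointDensity β f) :
    Integrable ((typeSpace β).indicator f) (volume.prod volume) :=
  (integrable_indicator_iff (measurableSet_typeSpace β)).2 hf.integrable

theorem integrable_density₁ (hf : IsJointDensity β f) :
    IntegrableOn (density₁ f) (Icc 0 β) := by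
  refine (hf.integrable_indicator.integral_prod_left.integrableOn (s := Icc 0 β)).congr_fun
    (fun x hx => ?_) measurableSet_Icc
  simp only [density₁]
  rw [← integral_indicator measurableSet_Icc]
  congr 1 with y
  by_cases hy : y ∈ Icc 0 x
  · rw [indicator_of_mem hy,
        indicator_of_mem (show (x, y) ∈ typeSpace β from ⟨hx, ⟨hy.1, hy.2.trans hx.2⟩, hy.2⟩)]
  · rw [indicator_of_notMem hy, indicator_of_notMem fun hv => hy ⟨hv.2.1.1, hv.2.2⟩]

theorem integrable_density₂ (hf : IsJointDensity β f) :
    IntegrableOn (density₂ β f) (Icc 0 β) := by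
  refine (hf.integrable_indicator.integral_prod_right.integrableOn (s := Icc 0 β)).congr_fun
    (fun y hy => ?_) measurableSet_Icc
  simp only [density₂]
  rw [← integral_indicator measurableSet_Icc]
  congr 1 with x
  by_cases hx : x ∈ Icc y β
  · rw [indicator_of_mem hx,
        indicator_of_mem (show (x, y) ∈ typeSpace β from ⟨⟨hy.1.trans hx.1, hx.2⟩, hy, hx.1⟩)]
  · rw [indicator_of_notMem hx, indicator_of_notMem fun hv => hx ⟨hv.2.2, hv.1.2⟩]

theorem cdf₁_eq (hf : IsJointDensity β f) {x : ℝ} (hx : x ∈ Icc 0 β) :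
    cdf₁ β f x = ∫ t in (0 : ℝ)..x, density₁ f t := by
  have hS : MeasurableSet {v : ℝ × ℝ | v.1 ≤ x} := measurableSet_le measurable_fst measurable_const
  have hm : Measurable ((Iic x).indicator fun _ => (1 : ℝ)) :=
    measurable_const.indicator measurableSet_Iic
  have := setIntegral_mul_fst (hf.integrableOn_mul_fst hm
    ⟨1, fun t _ => by by_cases ht : t ∈ Iic x <;> simp [ht]⟩)
  rw [cdf₁, ← setIntegral_indicator hS, intervalIntegral.integral_of_le hx.1,
    ← integral_Icc_eq_integral_Ioc]
  have e : Icc 0 x = Icc 0 β ∩ Iic x := by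
    ext t; constructor
    · exact fun h => ⟨⟨h.1, h.2.trans hx.2⟩, h.2⟩
    · exact fun h => ⟨h.1.1, h.2⟩
  rw [e, ← setIntegral_indicator measurableSet_Iic]
  convert! this using 2 with v t
  · funext v
    by_cases hv : v.1 ≤ x <;> simp [indicator, hv]
  · funext t
    by_cases ht : t ≤ x <;> simp [indicator, ht]

theorem cdf₂_eq (hf : IsJointDensity β f) {x : ℝ} (hx : x ∈ Icc 0 β) :
    cdf₂ β f x = ∫ t in (0 : ℝ)..x, density₂ β f t := by
  have hS : MeasurableSet {v : ℝ × ℝ | v.2 ≤ x} := measurableSet_le measurable_snd measurable_const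
  have hm : Measurable ((Iic x).indicator fun _ => (1 : ℝ)) :=
    measurable_const.indicator measurableSet_Iic
  have := setIntegral_mul_snd (hf.integrableOn_mul_snd hm
    ⟨1, fun t _ => by by_cases ht : t ∈ Iic x <;> simp [ht]⟩)
  rw [cdf₂, ← setIntegral_indicator hS, intervalIntegral.integral_of_le hx.1,
    ← integral_Icc_eq_integral_Ioc]
  have e : Icc 0 x = Icc 0 β ∩ Iic x := by
    ext t; constructor
    · exact fun h => ⟨⟨h.1, h.2.trans hx.2⟩, h.2⟩
    · exact fun h => ⟨h.1.1, h.2⟩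
  rw [e, ← setIntegral_indicator measurableSet_Iic]
  convert! this using 2 with v t
  · funext v
    by_cases hv : v.2 ≤ x <;> simp [indicator, hv]
  · funext t
    by_cases ht : t ≤ x <;> simp [indicator, ht]

theorem isMarginal₁ (hf : IsJointDensity β f) (hβ : 0 < β)
    (hd : DifferentiableOn ℝ (density₁ f) (Ioo 0 β)) :
    IsMarginal β (cdf₁ β f) (density₁ f) := by
  refine .of_primitive hβ hf.integrable_density₁ (fun x hx => ?_) hd.continuousOn
    (fun x hx => hf.cdf₁_eq hx) ?_
  · exact setIntegral_nonneg measurableSet_Icc fun y hy =>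
      hf.nonneg _ ⟨hx, ⟨hy.1, hy.2.trans hx.2⟩, hy.2⟩
  · rw [cdf₁, inter_eq_left.2 fun v hv => hv.1.2, hf.total]

theorem isMarginal₂ (hf : IsJointDensity β f) (hβ : 0 < β)
    (hd : DifferentiableOn ℝ (density₂ β f) (Ioo 0 β)) :
    IsMarginal β (cdf₂ β f) (density₂ β f) := by
  refine .of_primitive hβ hf.integrable_density₂ (fun y hy => ?_) hd.continuousOn
    (fun x hx => hf.cdf₂_eq hx) ?_
  · exact setIntegral_nonneg measurableSet_Icc fun x hx =>
      hf.nonneg _ ⟨⟨hy.1.trans hx.1, hx.2⟩, hy, hx.1⟩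
  · rw [cdf₂, inter_eq_left.2 fun v hv => hv.2.1.2, hf.total]

end IsJointDensity

end BudgetSale

namespace BudgetSale

/-! ### Revenue bounds for one-dimensional screening -/

variable {β κ a c s x y : ℝ} {F g : ℝ → ℝ} {X : Set (ℝ × ℝ)}

namespace IsMarginal

theorem integrableOn_payment (hF : IsMarginal β F g) (hX : IsMenu X) :
    IntegrableOn (fun x => menuPayment X x * g x) (Icc 0 β) :=
  hF.integrableOn_mul hX.measurable_payment (hX.exists_abs_payment_le β)

theorem hasDerivWithinAt_value_mul (hF : IsMarginal β F g) (hX : IsMenu X) (hx : x ∈ Ioo 0 β) :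
    HasDerivWithinAt (fun x => menuValue X x * (1 - F x))
      (menuSlope X x * (1 - F x) - menuValue X x * g x) (Ioi x) x := by
  refine ((hX.hasDerivWithinAt x).mul
    ((hF.hasDerivAt x hx).const_sub 1).hasDerivWithinAt).congr_deriv ?_
  ring

theorem continuousOn_value_mul (hF : IsMarginal β F g) (hX : IsMenu X) :
    ContinuousOn (fun x => menuValue X x * (1 - F x)) (Icc 0 β) :=
  hX.continuous.continuousOn.mul (continuousOn_const.sub hF.continuousOn)

/-- Where the slope of the price-revenue curve, weighted by the allocation, exceeds its value
at the constant allocation `a` and multiplier `s`, payments are bounded by integrating by parts. -/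
theorem integral_payment_le (hF : IsMarginal β F g) (hX : IsMenu X) (hx : x ∈ Icc 0 β)
    (hy : y ∈ Icc 0 β) (hxy : x ≤ y)
    (h : ∀ t ∈ Ioo x y, 0 ≤ (menuSlope X t - a) * (1 - F t - t * g t - s)) :
    ∫ t in x..y, menuPayment X t * g t ≤
      (menuValue X y * (1 - F y) - a * (y * (1 - F y)) - s * (menuValue X y - a * y)) -
      (menuValue X x * (1 - F x) - a * (x * (1 - F x)) - s * (menuValue X x - a * x)) := by
  have hsub : Icc x y ⊆ Icc 0 β := Icc_subset_Icc hx.1 hy.2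
  have hsub' : Ioo x y ⊆ Ioo 0 β := Ioo_subset_Ioo hx.1 hy.2
  -- With V the value and R(t) = t(1 − F(t)), the payment times g equals (V(1 − F))' − V'R'. The
  -- hypothesis says exactly that this is at most (V(1 − F))' − aR' − s(V' − a). Right derivatives
  -- suffice, which is all that convexity of V provides everywhere.
  refine intervalIntegral.integral_le_sub_of_hasDeriv_right_of_le
    (g := fun t => menuValue X t * (1 - F t) - a * (t * (1 - F t)) - s * (menuValue X t - a * t))
    (g' := fun t => (menuSlope X t * (1 - F t) - menuValue X t * g t) -
      a * (1 - F t - t * g t) - s * (menuSlope X t - a * 1)) hxy ?_ (fun t ht => ?_)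
    ((hF.integrableOn_payment hX).mono_set hsub) (fun t ht => ?_)
  · exact (((hF.continuousOn_value_mul hX).sub (continuousOn_const.mul hF.continuousOn_price)).sub
      (continuousOn_const.mul (hX.continuous.continuousOn.sub
        (continuousOn_const.mul continuousOn_id)))).mono hsub
  · exact ((hF.hasDerivWithinAt_value_mul hX (hsub' ht)).sub
      ((hF.hasDerivAt_price (hsub' ht)).const_mul a).hasDerivWithinAt).sub
      (((hX.hasDerivWithinAt t).sub
        (((hasDerivAt_id t).const_mul a).hasDerivWithinAt)).const_mul s)
  · have := h t ht
    simp only [menuPayment]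
    linarith

/-- The multiplier for the constraint fixing the utility gain on [0, κ]: by concavity, the slope of
R(t) = t(1 − F(t)) at the jump point `x` separates its slopes on the two sides. The endpoints are
treated apart, since differentiability of R is known only inside (0, β). -/
theorem exists_multiplier (hF : IsMarginal β F g)
    (hconc : ConcaveOn ℝ (Icc 0 β) fun x => x * (1 - F x)) (hX : IsMenu X) (hκ : κ ∈ Ioc 0 β)
    (hx : x ∈ Icc 0 κ) (hval : x = κ → menuValue X κ = menuValue X 0) :
    ∃ s, (∀ t ∈ Ioo 0 x, 0 ≤ (menuSlope X t - 0) * (1 - F t - t * g t - s)) ∧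
      ∀ t ∈ Ioo x κ, 1 - F t - t * g t ≤ s := by
  have hanti : ∀ t ∈ Ioo 0 β, ∀ t' ∈ Ioo 0 β, t ≤ t' →
      1 - F t' - t' * g t' ≤ 1 - F t - t * g t := fun t ht t' ht' htt' => by
    have := (hconc.subset Ioo_subset_Icc_self (convex_Ioo 0 β)).antitoneOn_deriv
      (fun u hu => (hF.hasDerivAt_price hu).differentiableAt) ht ht' htt'
    rwa [(hF.hasDerivAt_price ht).deriv, (hF.hasDerivAt_price ht').deriv] at this
  rcases hx.1.eq_or_lt with rfl | h0
  · refine ⟨1, by simp, fun t ht => ?_⟩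
    have htm : t ∈ Icc 0 β := ⟨ht.1.le, ht.2.le.trans hκ.2⟩
    have := mul_nonneg ht.1.le (hF.nonneg t htm)
    have := hF.cdf_nonneg htm
    linarith
  rcases hx.2.eq_or_lt with rfl | h1
  · refine ⟨0, fun t ht => ?_, by simp⟩
    have e1 := hX.subgradient t x
    have e2 := hX.subgradient 0 t
    have e3 := mul_nonneg (hX.slope_nonneg 0) ht.1.le
    rw [hval rfl] at e1
    have : menuSlope X t * (x - t) ≤ 0 * (x - t) := by linarith
    have := le_antisymm (le_of_mul_le_mul_right this (sub_pos.2 ht.2)) (hX.slope_nonneg t)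
    simp [this]
  · have hxm : x ∈ Ioo 0 β := ⟨h0, h1.trans_le hκ.2⟩
    refine ⟨1 - F x - x * g x, fun t ht => ?_, fun t ht => ?_⟩
    · have := hanti t ⟨ht.1, ht.2.trans hxm.2⟩ x hxm ht.2.le
      rw [sub_zero]
      exact mul_nonneg (hX.slope_nonneg t) (sub_nonneg.2 this)
    · exact hanti x hxm t ⟨h0.trans ht.1, ht.2.trans_le hκ.2⟩ ht.1.le

/-- Below `κ`, a menu with allocations at most `a` earns no more than the single posted price
which gives the type `κ` the same utility gain, when the price-revenue curve is concave. -/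
theorem integral_payment_le_of_concave (hF : IsMarginal β F g)
    (hconc : ConcaveOn ℝ (Icc 0 β) fun x => x * (1 - F x)) (hX : IsMenu X) (hκ : κ ∈ Ioc 0 β)
    (ha : 0 < a) (hslope : menuSlope X κ ≤ a)
    (hx : a * x = a * κ - menuValue X κ + menuValue X 0) :
    x ∈ Icc 0 κ ∧ ∫ t in (0 : ℝ)..κ, menuPayment X t * g t ≤
      menuValue X κ * (1 - F κ) - menuValue X 0 -
        a * (κ * (1 - F κ) - x * (1 - F x)) := by
  have hxm : x ∈ Icc 0 κ := by
    constructor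
    · have := hX.subgradient κ 0
      have := mul_le_mul_of_nonneg_right hslope hκ.1.le
      refine le_of_mul_le_mul_left ?_ ha
      linarith
    · have := hX.subgradient 0 κ
      have := mul_nonneg (hX.slope_nonneg 0) hκ.1.le
      refine le_of_mul_le_mul_left ?_ ha
      linarith
  refine ⟨hxm, ?_⟩
  obtain ⟨s, hs1, hs2⟩ := hF.exists_multiplier hconc hX hκ hxm (by rintro rfl; linarith)
  have h0m : (0 : ℝ) ∈ Icc 0 β := ⟨le_rfl, hF.pos.le⟩
  have hxβ : x ∈ Icc 0 β := ⟨hxm.1, hxm.2.trans hκ.2⟩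
  have hκβ : κ ∈ Icc 0 β := Ioc_subset_Icc_self hκ
  have h1 := hF.integral_payment_le hX h0m hxβ hxm.1 hs1
  have h2 := hF.integral_payment_le hX hxβ hκβ hxm.2 (a := a) (s := s) fun t ht =>
    mul_nonneg_of_nonpos_of_nonpos
      (sub_nonpos.2 ((hX.slope_mono ht.2.le).trans hslope)) (sub_nonpos.2 (hs2 t ht))
  have hint : ∀ u ∈ Icc 0 β, ∀ v ∈ Icc 0 β,
      IntervalIntegrable (fun t => menuPayment X t * g t) volume u v := fun u hu v hv =>
    ((hF.integrableOn_payment hX).mono_set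
      (ordConnected_Icc.uIcc_subset hu hv)).intervalIntegrable
  rw [← intervalIntegral.integral_add_adjacent_intervals (hint 0 h0m x hxβ) (hint x hxβ κ hκβ)]
  rw [hF.zero] at h1
  have h3 : s * (a * x) = s * (a * κ - menuValue X κ + menuValue X 0) := by rw [hx]
  linarith

/-- Above `κ`, a menu with allocations at least `a` earns no more than the menu offering the
remaining `1 - a` at the best posted price, when price revenue is single-peaked. -/
theorem integral_payment_le_of_singlePeaked (hF : IsMarginal β F g)
    (hinc : ∀ t ∈ Ioo 0 c, 0 ≤ 1 - F t - t * g t)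
    (hdec : ∀ t ∈ Ioo c β, 1 - F t - t * g t ≤ 0) (hc : c ≤ β) (hX : IsMenu X)
    (hκ : κ ∈ Icc 0 β) (hslope : ∀ t ∈ Ioo κ β, a ≤ menuSlope X t) :
    ∫ t in κ..β, menuPayment X t * g t ≤
      a * (κ * (1 - F κ)) - menuValue X κ * (1 - F κ) +
        (1 - a) * (max κ c * (1 - F (max κ c))) := by
  have hβm : β ∈ Icc 0 β := ⟨hF.pos.le, le_rfl⟩
  have hmm : max κ c ∈ Icc 0 β := ⟨hκ.1.trans (le_max_left _ _), max_le hκ.2 hc⟩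
  -- No utility is prescribed at the right end, hence multiplier 0: allocate as little as possible
  -- (a) before the peak, as much as possible (1) after it.
  have h1 := hF.integral_payment_le hX hκ hmm (le_max_left _ _) (a := a) (s := 0) fun t ht => by
    rcases lt_max_iff.1 ht.2 with h | h
    · exact absurd h ht.1.not_gt
    · rw [sub_zero]
      exact mul_nonneg (sub_nonneg.2 (hslope t ⟨ht.1, ht.2.trans_le hmm.2⟩))
        (hinc t ⟨hκ.1.trans_lt ht.1, h⟩)
  have h2 := hF.integral_payment_le hX hmm hβm hmm.2 (a := 1) (s := 0) fun t ht => by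
    rw [sub_zero]
    exact mul_nonneg_of_nonpos_of_nonpos (sub_nonpos.2 (hX.slope_le_one t))
      (hdec t ⟨(le_max_right _ _).trans_lt ht.1, ht.2⟩)
  have hint : ∀ u ∈ Icc 0 β, ∀ v ∈ Icc 0 β,
      IntervalIntegrable (fun t => menuPayment X t * g t) volume u v := fun u hu v hv =>
    ((hF.integrableOn_payment hX).mono_set
      (ordConnected_Icc.uIcc_subset hu hv)).intervalIntegrable
  rw [← intervalIntegral.integral_add_adjacent_intervals (hint κ hκ _ hmm) (hint _ hmm β hβm)]
  rw [hF.top] at h2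
  linarith

end IsMarginal

end BudgetSale

namespace BudgetSale

/-! ### Upper bound on the revenue of incentive compatible mechanisms -/

variable {β b κ a c x y : ℝ} {f : ℝ × ℝ → ℝ} {v z : ℝ × ℝ}

theorem zero_mem_typeSpace (hx : x ∈ Icc 0 β) : (x, (0 : ℝ)) ∈ typeSpace β :=
  ⟨hx, ⟨le_rfl, hx.1.trans hx.2⟩, hx.1⟩

/-- Expected revenue of the POST-2 mechanism with prices `κ₁, κ₂`. -/
noncomputable def post2Revenue (β b : ℝ) (f : ℝ × ℝ → ℝ) (κ₁ κ₂ : ℝ) : ℝ :=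
  b * (1 - cdf₁ β f κ₁) + (1 - b / κ₁) * (κ₂ * (1 - cdf₂ β f κ₂))

namespace Mechanism

variable {N : Mechanism β}

theorem mem_menu (N : Mechanism β) (hv : v ∈ typeSpace β) : (N.q v, N.p v) ∈ N.menu :=
  mem_image_of_mem (fun v => (N.q v, N.p v)) hv

/-- A type either chooses the best affordable outcome for the agent, or an unaffordable outcome
which is best for the principal. -/
theorem IC.choice (hN : N.IC b) (hv : v ∈ typeSpace β) :
    (N.p v ≤ b ∧ (N.q v, N.p v) ∈ bestChoices (budgetSet b N.menu) v.1) ∨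
      (b < N.p v ∧ (N.q v, N.p v) ∈ bestChoices N.menu v.2) := by
  have h := hN v hv
  unfold pairChoice at h
  split_ifs at h with hs
  · by_cases hp : b < N.p v
    · exact .inr ⟨hp, h⟩
    -- An affordable principal-best outcome is weakly preferred by the agent to an agent-best
    -- affordable one, hence is itself agent-best.
    · obtain ⟨hw, _, _, z', hz', _⟩ := hs
      refine .inl ⟨not_lt.1 hp, ⟨N.mem_menu hv, not_lt.1 hp⟩, fun w hwm => ?_⟩
      exact (hz'.2 w hwm).trans (hw _ h z' hz')
  · exact .inl ⟨h.1.2, h⟩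

/-- The type (x, 0) has a nonempty choice set. If it follows the principal, the strict preference
still supplies an agent-best affordable outcome. -/
theorem IC.exists_affordable (hN : N.IC b) (hx : x ∈ Icc 0 β) :
    (bestChoices (budgetSet b N.menu) x).Nonempty := by
  have h := hN _ (zero_mem_typeSpace hx)
  unfold pairChoice at h
  split_ifs at h with hs
  · obtain ⟨_, _, _, z', hz', _⟩ := hs
    exact ⟨z', hz'⟩
  · exact ⟨_, h⟩

theorem alloc_mem_of_mem_menu (hz : z ∈ N.menu) : z.1 ∈ Icc (0 : ℝ) 1 := by
  obtain ⟨v, hv, rfl⟩ := hz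
  exact N.q_mem v hv

theorem IR.mem_budgetSet (hb : 0 < b) (hN : N.IR) : (0, 0) ∈ budgetSet b N.menu := ⟨hN, hb.le⟩

/-- At valuation 0 utility is minus the payment, so a best affordable outcome there has the least
payment in the whole menu. -/
theorem IC.isMenu (hβ : 0 < β) (hb : 0 < b) (hN : N.IC b) (hIR : N.IR) : IsMenu N.menu := by
  obtain ⟨z₀, hz₀⟩ := hN.exists_affordable (x := 0) ⟨le_rfl, hβ.le⟩
  refine ⟨⟨_, hIR⟩, fun z hz => alloc_mem_of_mem_menu hz, z₀.2, fun z hz => ?_⟩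
  have hle : z₀.2 ≤ 0 := by
    have := hz₀.2 _ (hIR.mem_budgetSet hb)
    simpa [utility] using this
  by_cases h : z.2 ≤ b
  · have := hz₀.2 z ⟨hz, h⟩
    simpa [utility] using this
  · linarith

theorem IC.isMenu_budgetSet (hβ : 0 < β) (hb : 0 < b) (hN : N.IC b) (hIR : N.IR) :
    IsMenu (budgetSet b N.menu) := by
  obtain ⟨_, _, C, hC⟩ := hN.isMenu hβ hb hIR
  exact ⟨⟨_, hIR.mem_budgetSet hb⟩, fun z hz => alloc_mem_of_mem_menu hz.1, C,
    fun z hz => hC z hz.1⟩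

/-- Beyond `κ` the principal gains from unaffordable outcomes; up to `κ`, she does not. -/
theorem IC.exists_threshold (hβ : 0 < β) (hb : 0 < b) (hN : N.IC b) (hIR : N.IR) :
    ∃ κ ∈ Ioc 0 β, menuValue N.menu κ = menuValue (budgetSet b N.menu) κ ∧
      ∀ y ∈ Ioc κ β, menuValue (budgetSet b N.menu) y < menuValue N.menu y := by
  have hX := hN.isMenu hβ hb hIR
  have hB := hN.isMenu_budgetSet hβ hb hIR
  have hle := hB.value_mono hX fun z hz => hz.1
  let S := {y ∈ Icc 0 β | menuValue N.menu y = menuValue (budgetSet b N.menu) y}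
  have hS : IsCompact S :=
    isCompact_Icc.inter_right (isClosed_eq hX.continuous hB.continuous)
  -- At a valuation of at most b, an outcome costing more than b has negative utility and loses to
  -- (0, 0).
  have hmem : min b β ∈ S := by
    refine ⟨⟨(lt_min hb hβ).le, min_le_right _ _⟩, le_antisymm (hX.value_le fun z hz => ?_) (hle _)⟩
    by_cases h : z.2 ≤ b
    · exact hB.utility_le ⟨hz, h⟩ _
    · have h1 := hB.utility_le (hIR.mem_budgetSet hb) (min b β)
      have h2 := alloc_mem_of_mem_menu hz
      have h3 := mul_le_mul (min_le_left b β) h2.2 h2.1 hb.le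
      simp only [utility] at *
      linarith
  obtain ⟨κ, hκ, hmax⟩ := hS.exists_isGreatest ⟨_, hmem⟩
  have hκ0 : 0 < κ := (lt_min hb hβ).trans_le (hmax hmem)
  refine ⟨κ, ⟨hκ0, hκ.1.2⟩, hκ.2, fun y hy => lt_of_le_of_ne (hle y) fun he => ?_⟩
  exact hy.1.not_ge (hmax ⟨⟨(hκ0.trans hy.1).le, hy.2⟩, he.symm⟩)

/-- If a principal below κ chose an outcome costing more than b, it would allocate more than the
best affordable outcome at κ. By increasing differences it would then be strictly better at κ, where
the two indirect utilities agree. -/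
theorem IC.payment_le_budget (hβ : 0 < β) (hb : 0 < b) (hN : N.IC b) (hIR : N.IR)
    (hκ : κ ∈ Ioc 0 β) (hval : menuValue N.menu κ = menuValue (budgetSet b N.menu) κ)
    (hv : v ∈ typeSpace β) (hvκ : v.2 < κ) : N.p v ≤ b := by
  rcases hN.choice hv with h | ⟨hp, hbest⟩
  · exact h.1
  exfalso
  have hX := hN.isMenu hβ hb hIR
  have hB := hN.isMenu_budgetSet hβ hb hIR
  obtain ⟨w, hw⟩ := hN.exists_affordable (Ioc_subset_Icc_self hκ)
  have h1 := hbest.2 w hw.1.1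
  have h2 := hX.utility_le (N.mem_menu hv) κ
  rw [hval, hB.value_eq hw] at h2
  have h3 := hw.1.2
  simp only [utility] at h1 h2
  have h4 : 0 < v.2 * (N.q v - w.1) := by linarith
  have h5 : 0 < N.q v - w.1 := pos_of_mul_pos_right h4 hv.2.1.1
  have h6 := mul_lt_mul_of_pos_right hvκ h5
  linarith

theorem le_menuPayment_of_value_lt (hX : IsMenu N.menu) (hy : 0 < y)
    (h : menuValue (budgetSet b N.menu) y < menuValue N.menu y)
    (hB : IsMenu (budgetSet b N.menu)) : b ≤ menuPayment N.menu y := by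
  refine hX.le_menuPayment hy h fun z hz hlt => ?_
  by_contra! hzb
  exact hlt.not_ge (hB.utility_le ⟨hz, hzb.le⟩ y)

/-- The allocation which makes the type `κ`, at its indirect utility, pay exactly the budget is
a lower bound for the allocations beyond `κ`. -/
theorem le_menuSlope_of_value_lt (hX : IsMenu N.menu) (hB : IsMenu (budgetSet b N.menu))
    (hκ : 0 < κ) (h : ∀ y ∈ Ioc κ β, menuValue (budgetSet b N.menu) y < menuValue N.menu y)
    (hy : y ∈ Ioc κ β) : b + menuValue N.menu κ ≤ κ * menuSlope N.menu y := by
  have hc : ContinuousWithinAt (fun t => b + menuValue N.menu t) (Ioo κ y) κ :=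
    (continuous_const.add hX.continuous).continuousWithinAt
  have hc' : ContinuousWithinAt (fun t => t * menuSlope N.menu y) (Ioo κ y) κ :=
    (continuous_id.mul continuous_const).continuousWithinAt
  refine hc.closure_le ?_ hc' fun t ht => ?_
  · rw [closure_Ioo hy.1.ne]
    exact ⟨le_rfl, hy.1.le⟩
  -- The payment at t ∈ (κ, y) is at least b. Replacing the slope at t by the larger one at y makes
  -- both sides continuous in t, so t can tend to κ.
  · have ht0 : 0 < t := hκ.trans ht.1
    have h1 := le_menuPayment_of_value_lt hX ht0 (h t ⟨ht.1, ht.2.le.trans hy.2⟩) hB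
    have h2 := mul_le_mul_of_nonneg_left (hX.slope_mono ht.2.le) ht0.le
    unfold menuPayment at h1
    linarith

/-- The separable bound p(v) ≤ φ₁(v₁) + φ₂(v₂) removes the dependence on the correlation between the
two values. -/
theorem IC.revenue_le_integral (hβ : 0 < β) (hb : 0 < b) (hf : IsJointDensity β f)
    (h₁ : IsMarginal β (cdf₁ β f) (density₁ f)) (h₂ : IsMarginal β (cdf₂ β f) (density₂ β f))
    (hN : N.IC b) (hIR : N.IR) (hrev : N.HasRevenue f) (hκ : κ ∈ Ioc 0 β)
    (hval : menuValue N.menu κ = menuValue (budgetSet b N.menu) κ)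
    (hlt : ∀ y ∈ Ioc κ β, menuValue (budgetSet b N.menu) y < menuValue N.menu y) :
    N.revenue f ≤
      ((∫ t in (0 : ℝ)..κ, menuPayment (budgetSet b N.menu) t * density₁ f t) +
        b * (1 - cdf₁ β f κ)) +
      ((∫ t in κ..β, menuPayment N.menu t * density₂ β f t) - b * (1 - cdf₂ β f κ)) := by
  have hX := hN.isMenu hβ hb hIR
  have hB := hN.isMenu_budgetSet hβ hb hIR
  set P₁ := menuPayment (budgetSet b N.menu)
  set P₂ := menuPayment N.menu
  -- If v₂ > κ then v₁ > κ as well, so φ₁ contributes b and φ₂ adds only the excess of the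
  -- principal's payment over the budget.
  let φ₁ : ℝ → ℝ := fun x => if x ≤ κ then P₁ x else b
  let φ₂ : ℝ → ℝ := fun y => if y ≤ κ then 0 else P₂ y - b
  have hφ₁ : Measurable φ₁ :=
    Measurable.ite measurableSet_Iic hB.measurable_payment measurable_const
  have hφ₂ : Measurable φ₂ :=
    Measurable.ite measurableSet_Iic measurable_const (hX.measurable_payment.sub measurable_const)
  have hbd₁ : ∃ C, ∀ x ∈ Icc 0 β, |φ₁ x| ≤ C := by
    obtain ⟨C, hC⟩ := hB.exists_abs_payment_le β
    refine ⟨max C |b|, fun x hx => ?_⟩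
    by_cases h : x ≤ κ
    · simp only [φ₁, if_pos h]
      exact (hC x hx).trans (le_max_left _ _)
    · simp only [φ₁, if_neg h]
      exact le_max_right _ _
  have hbd₂ : ∃ C, ∀ x ∈ Icc 0 β, |φ₂ x| ≤ C := by
    obtain ⟨C, hC⟩ := hX.exists_abs_payment_le β
    refine ⟨C + |b|, fun x hx => ?_⟩
    by_cases h : x ≤ κ
    · simp only [φ₂, if_pos h, abs_zero]
      exact add_nonneg ((abs_nonneg _).trans (hC x hx)) (abs_nonneg b)
    · simp only [φ₂, if_neg h]
      exact (abs_sub _ _).trans (add_le_add_left (hC x hx) _)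
  have hi₁ := hf.integrableOn_mul_fst hφ₁ hbd₁
  have hi₂ := hf.integrableOn_mul_snd hφ₂ hbd₂
  -- At v₂ = κ a tie may be resolved by an unaffordable outcome; this line is null.
  have hne : ∀ᵐ v : ℝ × ℝ, v.2 ≠ κ := by
    rw [Measure.volume_eq_prod]
    exact Measure.quasiMeasurePreserving_snd.ae (compl_mem_ae_iff.2 (measure_singleton κ))
  have hpt : ∀ v ∈ typeSpace β, v.2 ≠ κ → N.p v ≤ φ₁ v.1 + φ₂ v.2 := by
    intro v hv hvκ
    rcases lt_or_gt_of_ne hvκ with h2 | h2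
    · have hpb := hN.payment_le_budget hβ hb hIR hκ hval hv h2
      simp only [φ₁, φ₂, if_pos h2.le, add_zero]
      split_ifs with h1
      · rcases hN.choice hv with h | h
        · exact hB.payment_le hv.1.1 h.2
        · exact absurd hpb h.1.not_ge
      · exact hpb
    · have h1 : κ < v.1 := h2.trans_le hv.2.2
      simp only [φ₁, φ₂, if_neg h1.not_ge, if_neg h2.not_ge, add_sub_cancel]
      rcases hN.choice hv with h | h
      · exact h.1.trans (le_menuPayment_of_value_lt hX (hκ.1.trans h2) (hlt _ ⟨h2, hv.2.1.2⟩) hB)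
      · exact hX.payment_le hv.2.1.1 h.2
  have hle : N.revenue f ≤ ∫ v in typeSpace β, (φ₁ v.1 * f v + φ₂ v.2 * f v) := by
    refine setIntegral_mono_on_ae hrev (hi₁.add hi₂) (measurableSet_typeSpace β) ?_
    filter_upwards [hne] with v hvκ hv
    rw [← add_mul]
    exact mul_le_mul_of_nonneg_right (hpt v hv hvκ) (hf.nonneg v hv)
  rw [integral_add hi₁ hi₂, setIntegral_mul_fst hi₁, setIntegral_mul_snd hi₂,
    integral_Icc_eq_integral_Ioc, integral_Icc_eq_integral_Ioc,
    ← intervalIntegral.integral_of_le hβ.le, ← intervalIntegral.integral_of_le hβ.le] at hle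
  refine hle.trans_eq ?_
  have h0m : (0 : ℝ) ∈ Icc 0 β := ⟨le_rfl, hβ.le⟩
  have hκm : κ ∈ Icc 0 β := Ioc_subset_Icc_self hκ
  have hβm : β ∈ Icc 0 β := ⟨hβ.le, le_rfl⟩
  have hii : ∀ {φ : ℝ → ℝ}, IntegrableOn φ (Icc 0 β) → ∀ s ∈ Icc 0 β, ∀ t ∈ Icc 0 β,
      IntervalIntegrable φ volume s t := fun hφ s hs t ht =>
    (hφ.mono_set (ordConnected_Icc.uIcc_subset hs ht)).intervalIntegrable
  have hj₁ := h₁.integrableOn_mul hφ₁ hbd₁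
  have hj₂ := h₂.integrableOn_mul hφ₂ hbd₂
  have hint₂ := h₂.integrableOn_payment hX
  congr 1
  · rw [← intervalIntegral.integral_add_adjacent_intervals (hii hj₁ 0 h0m κ hκm)
      (hii hj₁ κ hκm β hβm)]
    congr 1
    · refine intervalIntegral.integral_congr_uIoo fun t ht => ?_
      rw [uIoo_of_le hκ.1.le] at ht
      simp only [φ₁, if_pos ht.2.le]
    · rw [← h₁.top, ← h₁.integral κ hκm β hβm, ← intervalIntegral.integral_const_mul]
      refine intervalIntegral.integral_congr_uIoo fun t ht => ?_
      rw [uIoo_of_le hκ.2] at ht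
      simp only [φ₁, if_neg ht.1.not_ge]
  · rw [← intervalIntegral.integral_add_adjacent_intervals (hii hj₂ 0 h0m κ hκm)
      (hii hj₂ κ hκm β hβm)]
    have e0 : ∫ t in (0 : ℝ)..κ, φ₂ t * density₂ β f t = 0 := by
      refine (intervalIntegral.integral_congr_uIoo (g := fun _ => 0) fun t ht => ?_).trans
        intervalIntegral.integral_zero
      rw [uIoo_of_le hκ.1.le] at ht
      simp only [φ₂, if_pos ht.2.le, zero_mul]
    rw [e0, zero_add, ← h₂.top, ← h₂.integral κ hκm β hβm, ← intervalIntegral.integral_const_mul,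
      ← intervalIntegral.integral_sub (hii hint₂ κ hκm β hβm)
        ((hii h₂.integrable κ hκm β hβm).const_mul b)]
    refine intervalIntegral.integral_congr_uIoo fun t ht => ?_
    rw [uIoo_of_le hκ.2] at ht
    simp only [φ₂, if_neg ht.1.not_ge, sub_mul, P₂]

/-- Every incentive compatible and individually rational mechanism earns at most as much as some
POST-1 or POST-2 mechanism. -/
theorem IC.revenue_le (hβ : 0 < β) (hb : 0 < b) (hf : IsJointDensity β f)
    (h₁ : IsMarginal β (cdf₁ β f) (density₁ f)) (h₂ : IsMarginal β (cdf₂ β f) (density₂ β f))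
    (hconc : ConcaveOn ℝ (Icc 0 β) fun x => x * (1 - cdf₁ β f x)) (hc : c ∈ Icc 0 β)
    (hinc : ∀ t ∈ Ioo 0 c, 0 ≤ 1 - cdf₂ β f t - t * density₂ β f t)
    (hdec : ∀ t ∈ Ioo c β, 1 - cdf₂ β f t - t * density₂ β f t ≤ 0)
    (hN : N.IC b) (hIR : N.IR) (hrev : N.HasRevenue f) :
    (∃ κ ∈ Icc 0 b, κ ≤ β ∧ N.revenue f ≤ κ * (1 - cdf₁ β f κ)) ∨
      ∃ κ₁ κ₂, b ≤ κ₁ ∧ κ₁ ≤ κ₂ ∧ κ₂ ≤ β ∧ N.revenue f ≤ post2Revenue β b f κ₁ κ₂ := by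
  have hX := hN.isMenu hβ hb hIR
  have hB := hN.isMenu_budgetSet hβ hb hIR
  obtain ⟨κ, hκ, hval, hlt⟩ := hN.exists_threshold hβ hb hIR
  have hle := hN.revenue_le_integral hβ hb hf h₁ h₂ hIR hrev hκ hval hlt
  set u := menuValue (budgetSet b N.menu)
  have hu0 : 0 ≤ u 0 := by
    have := hB.utility_le (hIR.mem_budgetSet hb) 0
    simpa [utility] using this
  have huκ : 0 ≤ u κ := by
    have := hB.utility_le (hIR.mem_budgetSet hb) κ
    simpa [utility] using this
  have hpay : κ * menuSlope (budgetSet b N.menu) κ ≤ b + u κ := by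
    have := hB.menuPayment_le hκ.1 fun z hz => hz.2
    unfold menuPayment at this
    linarith
  by_cases ha : b + u κ ≤ κ
  -- With allocation a, type κ pays exactly b at utility u(κ). Affordable slopes at κ are at most a
  -- and unrestricted slopes beyond κ at least a, so both one-dimensional bounds apply with the same
  -- a.
  · obtain ⟨a, haκ⟩ : ∃ a, a * κ = b + u κ := ⟨(b + u κ) / κ, div_mul_cancel₀ _ hκ.1.ne'⟩
    have ha0 : 0 < a := pos_of_mul_pos_left (by rw [haκ]; linarith) hκ.1.le
    have ha1 : a ≤ 1 := le_of_mul_le_mul_right (by linarith) hκ.1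
    obtain ⟨κ₁, hκ₁⟩ : ∃ κ₁, a * κ₁ = b + u 0 := ⟨(b + u 0) / a, mul_div_cancel₀ _ ha0.ne'⟩
    obtain ⟨hm, hA⟩ := h₁.integral_payment_le_of_concave hconc hB hκ ha0
      (le_of_mul_le_mul_left (by linarith) hκ.1) (x := κ₁) (by linarith)
    have hP := h₂.integral_payment_le_of_singlePeaked hinc hdec hc.2 hX (Ioc_subset_Icc_self hκ)
      (a := a) fun t ht => by
        have := le_menuSlope_of_value_lt hX hB hκ.1 hlt ⟨ht.1, ht.2.le⟩
        rw [hval] at this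
        exact le_of_mul_le_mul_left (by linarith) hκ.1
    rw [hval] at hP
    have hbκ : b ≤ κ₁ := by
      have : a * κ₁ ≤ 1 * κ₁ := mul_le_mul_of_nonneg_right ha1 hm.1
      linarith
    have hκ₁0 : 0 < κ₁ := hb.trans_le hbκ
    set κ₂ := max κ c
    have hκ₂ : κ₂ ∈ Icc 0 β := ⟨hκ.1.le.trans (le_max_left _ _), max_le hκ.2 hc.2⟩
    refine .inr ⟨κ₁, κ₂, hbκ, hm.2.trans (le_max_left _ _), hκ₂.2, hle.trans ?_⟩
    have e1 : a * (κ * (1 - cdf₁ β f κ)) = (b + u κ) * (1 - cdf₁ β f κ) := by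
      rw [← haκ]; ring
    have e2 : a * (κ * (1 - cdf₂ β f κ)) = (b + u κ) * (1 - cdf₂ β f κ) := by
      rw [← haκ]; ring
    have e3 : a * (κ₁ * (1 - cdf₁ β f κ₁)) = (b + u 0) * (1 - cdf₁ β f κ₁) := by
      rw [← hκ₁]; ring
    have e4 : 0 ≤ u 0 * cdf₁ β f κ₁ :=
      mul_nonneg hu0 (h₁.cdf_nonneg ⟨hm.1, hm.2.trans hκ.2⟩)
    -- Equality holds when u(0) = 0; a positive u(0) is a subsidy, and discarding it only raises the
    -- bound.
    have e5 : b / κ₁ ≤ a := by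
      rw [div_le_iff₀ hκ₁0]; linarith
    have e6 : (1 - a) * (κ₂ * (1 - cdf₂ β f κ₂)) ≤ (1 - b / κ₁) * (κ₂ * (1 - cdf₂ β f κ₂)) :=
      mul_le_mul_of_nonneg_right (by linarith)
        (mul_nonneg hκ₂.1 (sub_nonneg.2 (h₂.le_one hκ₂)))
    unfold post2Revenue
    linarith
  -- Here a would exceed 1, yet it bounds from below the slopes beyond κ; so nothing lies beyond κ.
  · have hκβ : κ = β := by
      by_contra hne
      have hlt' : κ < β := lt_of_le_of_ne hκ.2 hne
      have := le_menuSlope_of_value_lt hX hB hκ.1 hlt ⟨hlt', le_rfl⟩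
      rw [hval] at this
      have := mul_le_mul_of_nonneg_left (hX.slope_le_one β) hκ.1.le
      exact ha (by linarith)
    subst hκβ
    obtain ⟨hm, hA⟩ := h₁.integral_payment_le_of_concave hconc hB hκ one_pos
      (hB.slope_le_one κ) (x := κ - u κ + u 0) (by simp only [u]; ring)
    set κ₁ := κ - u κ + u 0 with hκ₁
    have hmβ : κ₁ ∈ Icc 0 κ := hm
    rw [intervalIntegral.integral_same, h₁.top, h₂.top] at hle
    rw [h₁.top] at hA
    rcases le_total κ₁ b with hk | hk
    · refine .inl ⟨κ₁, ⟨hm.1, hk⟩, hm.2, ?_⟩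
      linarith
    -- With second price β only b(1 − F₁(κ₁)) is left. The excess κ₁ − b is at most u(0), which the
    -- bound already subtracts.
    · refine .inr ⟨κ₁, κ, hk, hm.2, le_rfl, ?_⟩
      have e1 : (κ₁ - b) * (1 - cdf₁ κ f κ₁) ≤ u 0 * 1 :=
        mul_le_mul (by linarith) (by linarith [h₁.cdf_nonneg hm])
          (sub_nonneg.2 (h₁.le_one hm)) hu0
      unfold post2Revenue
      rw [h₂.top]
      linarith

end Mechanism

end BudgetSale

namespace BudgetSale

/-! ### POST-1 and POST-2 mechanisms -/

variable {β b κ κ₁ κ₂ : ℝ} {f : ℝ × ℝ → ℝ}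

theorem setIntegral_indicator_fst_le (β : ℝ) (f : ℝ × ℝ → ℝ) (x : ℝ) :
    ∫ v in typeSpace β, {v | v.1 ≤ x}.indicator f v = cdf₁ β f x :=
  setIntegral_indicator (measurableSet_le measurable_fst measurable_const)

theorem setIntegral_indicator_snd_le (β : ℝ) (f : ℝ × ℝ → ℝ) (x : ℝ) :
    ∫ v in typeSpace β, {v | v.2 ≤ x}.indicator f v = cdf₂ β f x :=
  setIntegral_indicator (measurableSet_le measurable_snd measurable_const)

theorem IsJointDensity.integrableOn_indicator_fst_le (hf : IsJointDensity β f) (x : ℝ) :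
    IntegrableOn ({v | v.1 ≤ x}.indicator f) (typeSpace β) :=
  hf.integrable.indicator (measurableSet_le measurable_fst measurable_const)

theorem IsJointDensity.integrableOn_indicator_snd_le (hf : IsJointDensity β f) (x : ℝ) :
    IntegrableOn ({v | v.2 ≤ x}.indicator f) (typeSpace β) :=
  hf.integrable.indicator (measurableSet_le measurable_snd measurable_const)

namespace Mechanism

variable {M : Mechanism β}

theorem exists_isPost1 (β : ℝ) (hκ : κ ∈ Icc 0 b) : ∃ M : Mechanism β, M.IsPost1 b κ := by
  refine ⟨⟨fun v => if v.1 ≤ κ then 0 else 1, fun v => if v.1 ≤ κ then 0 else κ,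
    fun v _ => ?_⟩, hκ, fun v _ => ?_⟩
  · split_ifs <;> simp
  · dsimp only
    split_ifs <;> rfl

theorem exists_isPost2 (hb : 0 < b) (h₁ : b ≤ κ₁) (h₂ : κ₁ ≤ κ₂) (h₃ : κ₂ ≤ β) :
    ∃ M : Mechanism β, M.IsPost2 b κ₁ κ₂ := by
  refine ⟨⟨fun v => if v.1 < κ₁ then 0 else if κ₂ < v.2 then 1 else b / κ₁,
    fun v => if v.1 < κ₁ then 0 else if κ₂ < v.2 then b + κ₂ * (1 - b / κ₁) else b,
    fun v _ => ?_⟩, h₁, h₂, h₃, fun v _ => ?_⟩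
  · have : b / κ₁ ∈ Icc (0 : ℝ) 1 :=
      ⟨div_nonneg hb.le (hb.le.trans h₁), div_le_one_of_le₀ h₁ (hb.le.trans h₁)⟩
    split_ifs <;> simp [this.1, this.2]
  · dsimp only
    split_ifs <;> rfl

theorem IsPost1.revenue_eq (hf : IsJointDensity β f) (hM : M.IsPost1 b κ) :
    M.revenue f = κ * (1 - cdf₁ β f κ) := by
  have h : M.revenue f =
      ∫ v in typeSpace β, κ * (f v - {v : ℝ × ℝ | v.1 ≤ κ}.indicator f v) := by
    refine setIntegral_congr_fun (measurableSet_typeSpace β) fun v hv => ?_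
    have hp := congrArg Prod.snd (hM.2 v hv)
    dsimp only at hp ⊢
    rw [hp]
    by_cases h : v.1 ≤ κ <;> simp [h, indicator]
  rw [h, integral_const_mul, integral_sub hf.integrable (hf.integrableOn_indicator_fst_le κ),
    hf.total, setIntegral_indicator_fst_le]

theorem IsPost2.ae_eq (hM : M.IsPost2 b κ₁ κ₂) :
    (fun v => M.p v * f v) =ᵐ[volume.restrict (typeSpace β)] fun v =>
      b * (f v - {v : ℝ × ℝ | v.1 ≤ κ₁}.indicator f v) +
        κ₂ * (1 - b / κ₁) * (f v - {v : ℝ × ℝ | v.2 ≤ κ₂}.indicator f v) := by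
  -- POST-2 sells at v₁ = κ₁, whereas the distribution function counts that line as unsold.
  have hne : ∀ᵐ v : ℝ × ℝ, v.1 ≠ κ₁ := by
    rw [Measure.volume_eq_prod]
    exact Measure.quasiMeasurePreserving_fst.ae (compl_mem_ae_iff.2 (measure_singleton κ₁))
  refine (ae_restrict_iff' (measurableSet_typeSpace β)).2 ?_
  filter_upwards [hne] with v hvκ hv
  have hp := congrArg Prod.snd (hM.2.2.2 v hv)
  dsimp only at hp
  rw [hp]
  rcases lt_or_gt_of_ne hvκ with h | h
  · have h2 : v.2 ≤ κ₂ := (hv.2.2.trans h.le).trans hM.2.1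
    simp [h, h.le, h2, indicator]
  · by_cases h2 : κ₂ < v.2
    · simp [h.not_ge, h.not_gt, h2, h2.not_ge, indicator]
      ring
    · simp [h.not_ge, h.not_gt, h2, not_lt.1 h2, indicator]

theorem IsPost2.hasRevenue (hf : IsJointDensity β f) (hM : M.IsPost2 b κ₁ κ₂) :
    M.HasRevenue f :=
  Integrable.congr (((hf.integrable.sub (hf.integrableOn_indicator_fst_le κ₁)).const_mul _).add
    ((hf.integrable.sub (hf.integrableOn_indicator_snd_le κ₂)).const_mul _)) hM.ae_eq.symm

theorem IsPost2.revenue_eq (hf : IsJointDensity β f) (hM : M.IsPost2 b κ₁ κ₂) :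
    M.revenue f = post2Revenue β b f κ₁ κ₂ := by
  have i₁ := hf.integrableOn_indicator_fst_le κ₁
  have i₂ := hf.integrableOn_indicator_snd_le κ₂
  rw [revenue, integral_congr_ae hM.ae_eq,
    integral_add (by exact (hf.integrable.sub i₁).const_mul b)
      (by exact (hf.integrable.sub i₂).const_mul (κ₂ * (1 - b / κ₁))),
    integral_const_mul, integral_const_mul, integral_sub hf.integrable i₁,
    integral_sub hf.integrable i₂, hf.total, setIntegral_indicator_fst_le,
    setIntegral_indicator_snd_le, post2Revenue]
  ring

/-! ### Feasibility of POST-2 mechanisms -/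

theorem IsPost2.mem_menu_cases (hM : M.IsPost2 b κ₁ κ₂) {z : ℝ × ℝ} (hz : z ∈ M.menu) :
    z = (0, 0) ∨ z = (b / κ₁, b) ∨ z = (1, b + κ₂ * (1 - b / κ₁)) := by
  obtain ⟨v, hv, rfl⟩ := hz
  have := hM.2.2.2 v hv
  dsimp only
  rw [this]
  split_ifs <;> simp

theorem IsPost2.ir (hb : 0 < b) (hM : M.IsPost2 b κ₁ κ₂) : M.IR := by
  obtain ⟨h₁, h₂, h₃, h⟩ := hM
  have hκ : 0 < κ₁ := hb.trans_le h₁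
  have h0 : ((0 : ℝ), (0 : ℝ)) ∈ typeSpace β :=
    zero_mem_typeSpace ⟨le_rfl, (hκ.le.trans h₂).trans h₃⟩
  refine ⟨_, h0, ?_⟩
  dsimp only
  rw [h _ h0, if_pos hκ]

theorem IsPost2.affordable_mem_menu (hb : 0 < b) (hM : M.IsPost2 b κ₁ κ₂) :
    (b / κ₁, b) ∈ M.menu := by
  obtain ⟨h₁, h₂, h₃, h⟩ := hM
  have hκ : 0 < κ₁ := hb.trans_le h₁
  have h0 : (β, (0 : ℝ)) ∈ typeSpace β :=
    zero_mem_typeSpace ⟨(hκ.le.trans h₂).trans h₃, le_rfl⟩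
  refine ⟨_, h0, ?_⟩
  dsimp only
  rw [h _ h0, if_neg (h₂.trans h₃).not_gt, if_neg (hκ.le.trans h₂).not_gt]

/-- The menu is a two-step tariff: the fraction r = b/κ₁ at unit price κ₁, then the remaining 1 − r
at unit price κ₂. Since r < 1, the full purchase strictly exceeds the budget, so only a principal
can bring it about. -/
theorem IsPost2.ic (hb : 0 < b) (hbκ : b < κ₁) (hM : M.IsPost2 b κ₁ κ₂) : M.IC b := by
  intro v hv
  have hassigned := M.mem_menu hv
  have hz₀ : ((0 : ℝ), (0 : ℝ)) ∈ M.menu := hM.ir hb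
  have hz₁ := hM.affordable_mem_menu hb
  have hcases := fun z (hz : z ∈ M.menu) => hM.mem_menu_cases hz
  have h₁₂ := hM.2.1
  have hκ : 0 < κ₁ := hb.trans hbκ
  rw [hM.2.2.2 v hv] at hassigned ⊢
  have hv21 := hv.2.2
  set r := b / κ₁ with hr
  have hr0 : 0 < r := div_pos hb hκ
  have hr1 : r < 1 := (div_lt_one hκ).2 hbκ
  have hbr : b = r * κ₁ := by rw [hr, div_mul_cancel₀ _ hκ.ne']
  have hu₀ : ∀ x, utility x (0, 0) = 0 := fun x => by simp [utility]
  have hu₁ : ∀ x, utility x (r, b) = r * (x - κ₁) := fun x => by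
    simp only [utility]; linarith
  have hu₂ : ∀ x, utility x (1, b + κ₂ * (1 - r)) = r * (x - κ₁) + (1 - r) * (x - κ₂) :=
    fun x => by simp only [utility]; linarith
  have hunaff : b < b + κ₂ * (1 - r) :=
    lt_add_of_pos_right b (mul_pos (hκ.trans_le h₁₂) (sub_pos.2 hr1))
  by_cases hlow : v.1 < κ₁
  · rw [if_pos hlow] at hassigned ⊢
    unfold pairChoice
    split_ifs
    · refine ⟨hz₀, fun z hz => ?_⟩
      have e1 : r * (v.2 - κ₁) ≤ 0 := mul_nonpos_of_nonneg_of_nonpos hr0.le (by linarith)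
      have e2 : (1 - r) * (v.2 - κ₂) ≤ 0 :=
        mul_nonpos_of_nonneg_of_nonpos (by linarith) (by linarith)
      rcases hcases z hz with rfl | rfl | rfl <;> simp only [hu₀, hu₁, hu₂] <;> linarith
    · refine ⟨⟨hz₀, hb.le⟩, fun z hz => ?_⟩
      have e1 : r * (v.1 - κ₁) ≤ 0 := mul_nonpos_of_nonneg_of_nonpos hr0.le (by linarith)
      have e2 : (1 - r) * (v.1 - κ₂) ≤ 0 :=
        mul_nonpos_of_nonneg_of_nonpos (by linarith) (by linarith)
      rcases hcases z hz.1 with rfl | rfl | rfl <;> simp only [hu₀, hu₁, hu₂] <;> linarith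
  rw [if_neg hlow] at hassigned ⊢
  by_cases hhigh : κ₂ < v.2
  · rw [if_pos hhigh] at hassigned ⊢
    unfold pairChoice
    split_ifs with hs
    · refine ⟨hassigned, fun z hz => ?_⟩
      have e1 : 0 ≤ r * (v.2 - κ₁) := mul_nonneg hr0.le (by linarith)
      have e2 : 0 ≤ (1 - r) * (v.2 - κ₂) := mul_nonneg (by linarith) (by linarith)
      rcases hcases z hz with rfl | rfl | rfl <;> simp only [hu₀, hu₁, hu₂] <;> linarith
    · refine absurd ⟨fun z hz z' hz' => ?_, _, ⟨hassigned, fun z hz => ?_⟩, (r, b),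
        ⟨⟨hz₁, le_rfl⟩, fun z hz => ?_⟩, ?_⟩ hs
      · have e1 : 0 ≤ r * (v.2 - κ₁) := mul_nonneg hr0.le (by linarith)
        have e2 : 0 < (1 - r) * (v.2 - κ₂) := mul_pos (by linarith) (by linarith)
        have e3 : 0 ≤ r * (v.1 - κ₁) := mul_nonneg hr0.le (by linarith)
        have e4 : 0 ≤ (1 - r) * (v.1 - κ₂) := mul_nonneg (by linarith) (by linarith)
        have hbest := hz.2 _ hassigned
        rcases hcases z hz.1 with rfl | rfl | rfl
        · rw [hu₀, hu₂] at hbest; linarith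
        · rw [hu₁, hu₂] at hbest; linarith
        · rcases hcases z' hz'.1.1 with rfl | rfl | rfl <;> simp only [hu₀, hu₁, hu₂] <;> linarith
      · have e1 : 0 ≤ r * (v.2 - κ₁) := mul_nonneg hr0.le (by linarith)
        have e2 : 0 ≤ (1 - r) * (v.2 - κ₂) := mul_nonneg (by linarith) (by linarith)
        rcases hcases z hz with rfl | rfl | rfl <;> simp only [hu₀, hu₁, hu₂] <;> linarith
      · have e1 : 0 ≤ r * (v.1 - κ₁) := mul_nonneg hr0.le (by linarith)
        rcases hcases z hz.1 with rfl | rfl | rfl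
        · simp only [hu₀, hu₁]; linarith
        · exact le_rfl
        · exact absurd hz.2 hunaff.not_ge
      · rw [hu₁, hu₂]
        have : 0 < (1 - r) * (v.1 - κ₂) := mul_pos (by linarith) (by linarith)
        linarith
  · rw [if_neg hhigh] at hassigned ⊢
    unfold pairChoice
    split_ifs with hs
    · rcases le_or_gt κ₁ v.2 with h | h
      · refine ⟨hz₁, fun z hz => ?_⟩
        have e1 : 0 ≤ r * (v.2 - κ₁) := mul_nonneg hr0.le (by linarith)
        have e2 : (1 - r) * (v.2 - κ₂) ≤ 0 :=
          mul_nonpos_of_nonneg_of_nonpos (by linarith) (by linarith)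
        rcases hcases z hz with rfl | rfl | rfl <;> simp only [hu₀, hu₁, hu₂] <;> linarith
      -- A principal below κ₁ has (0, 0) as only best outcome; being affordable, it cannot strictly
      -- beat an agent-best affordable outcome.
      · exfalso
        obtain ⟨_, z, hz, z', hz', hlt⟩ := hs
        have e1 : r * (v.2 - κ₁) < 0 := mul_neg_of_pos_of_neg hr0 (by linarith)
        have e2 : (1 - r) * (v.2 - κ₂) ≤ 0 :=
          mul_nonpos_of_nonneg_of_nonpos (by linarith) (by linarith)
        have hbest := hz.2 _ hz₀
        rcases hcases z hz.1 with rfl | rfl | rfl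
        · exact hlt.not_ge (hz'.2 _ ⟨hz₀, hb.le⟩)
        · rw [hu₀, hu₁] at hbest; linarith
        · rw [hu₀, hu₂] at hbest; linarith
    · refine ⟨⟨hz₁, le_rfl⟩, fun z hz => ?_⟩
      have e1 : 0 ≤ r * (v.1 - κ₁) := mul_nonneg hr0.le (by linarith)
      rcases hcases z hz.1 with rfl | rfl | rfl
      · simp only [hu₀, hu₁]; linarith
      · exact le_rfl
      · exact absurd hz.2 hunaff.not_ge

end Mechanism

end BudgetSale

namespace BudgetSale

/-! ### The best POST-2 mechanism -/

variable {β b κ κ₁ κ₂ c k : ℝ} {f : ℝ × ℝ → ℝ} {F g : ℝ → ℝ}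

namespace IsMarginal

theorem strictMonoOn_price (hF : IsMarginal β F g) (hc : c ≤ β)
    (h : ∀ t ∈ Ioo 0 c, 0 < 1 - F t - t * g t) :
    StrictMonoOn (fun x => x * (1 - F x)) (Icc 0 c) := by
  refine strictMonoOn_of_deriv_pos (convex_Icc 0 c)
    (hF.continuousOn_price.mono (Icc_subset_Icc_right hc)) fun x hx => ?_
  rw [interior_Icc] at hx
  rw [(hF.hasDerivAt_price ⟨hx.1, hx.2.trans_le hc⟩).deriv]
  exact h x hx

theorem strictAntiOn_price (hF : IsMarginal β F g) (hc : 0 ≤ c)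
    (h : ∀ t ∈ Ioo c β, 1 - F t - t * g t < 0) :
    StrictAntiOn (fun x => x * (1 - F x)) (Icc c β) := by
  refine strictAntiOn_of_deriv_neg (convex_Icc c β)
    (hF.continuousOn_price.mono (Icc_subset_Icc_left hc)) fun x hx => ?_
  rw [interior_Icc] at hx
  rw [(hF.hasDerivAt_price ⟨hc.trans_lt hx.1, hx.2⟩).deriv]
  exact h x hx

end IsMarginal

/-- Under single crossing, the maximizer of the price revenue is the crossing point. -/
theorem SingleCrossing.of_isMaxOn (h₂ : IsMarginal β (cdf₂ β f) (density₂ β f))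
    (hpos : ∀ x ∈ Ioo 0 β, 0 < density₂ β f x) (hSC : SingleCrossing β f) (hk : k ∈ Icc 0 β)
    (hmax : IsMaxOn (fun x => x * (1 - cdf₂ β f x)) (Icc 0 β) k) :
    k ∈ Ioo 0 β ∧ (∀ t ∈ Ioo 0 k, 0 < 1 - cdf₂ β f t - t * density₂ β f t) ∧
      1 - cdf₂ β f k - k * density₂ β f k = 0 ∧
      ∀ t ∈ Ioo k β, 1 - cdf₂ β f t - t * density₂ β f t < 0 := by
  obtain ⟨c, hc, hneg, hzero, hpos'⟩ := hSC
  have h1 : ∀ t ∈ Ioo 0 c, 0 < 1 - cdf₂ β f t - t * density₂ β f t := fun t ht => by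
    have := hneg t ht
    rw [sub_neg, lt_div_iff₀ (hpos t ⟨ht.1, ht.2.trans hc.2⟩)] at this
    linarith
  have h2 : ∀ t ∈ Ioo c β, 1 - cdf₂ β f t - t * density₂ β f t < 0 := fun t ht => by
    have := hpos' t ht
    rw [sub_pos, div_lt_iff₀ (hpos t ⟨hc.1.trans ht.1, ht.2⟩)] at this
    linarith
  have hck := hmax (Ioo_subset_Icc_self hc)
  have : k = c := by
    rcases lt_trichotomy k c with h | h | h
    · exact absurd hck (h₂.strictMonoOn_price hc.2.le h1 ⟨hk.1, h.le⟩ ⟨hc.1.le, le_rfl⟩ h).not_ge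
    · exact h
    · exact absurd hck (h₂.strictAntiOn_price hc.1.le h2 ⟨le_rfl, hc.2.le⟩ ⟨h.le, hk.2⟩ h).not_ge
  subst this
  refine ⟨hc, h1, ?_, h2⟩
  rw [sub_eq_zero, eq_div_iff (hpos k hc).ne'] at hzero
  linarith

/-- The prices `κ₁, κ₂` maximize revenue among POST-2 mechanisms, and beat every POST-1
mechanism. -/
structure IsBestPost2 (β b : ℝ) (f : ℝ × ℝ → ℝ) (κ₁ κ₂ : ℝ) : Prop where
  budget_le : b ≤ κ₁
  le : κ₁ ≤ κ₂
  le_top : κ₂ ≤ β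
  isMax : ∀ k₁ k₂, b ≤ k₁ → k₁ ≤ k₂ → k₂ ≤ β →
    post2Revenue β b f k₁ k₂ ≤ post2Revenue β b f κ₁ κ₂
  beats : ∀ κ ∈ Icc 0 b, κ * (1 - cdf₁ β f κ) < post2Revenue β b f κ₁ κ₂

theorem continuousOn_post2Revenue (h₁ : IsMarginal β (cdf₁ β f) (density₁ f))
    (h₂ : IsMarginal β (cdf₂ β f) (density₂ β f)) :
    ContinuousOn (fun k : ℝ × ℝ => post2Revenue β b f k.1 k.2) (Ioc 0 β ×ˢ Icc 0 β) := by
  have hfst : ContinuousOn (fun k : ℝ × ℝ => cdf₁ β f k.1) (Ioc 0 β ×ˢ Icc 0 β) :=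
    h₁.continuousOn.comp continuousOn_fst fun k hk => Ioc_subset_Icc_self hk.1
  have hsnd : ContinuousOn (fun k : ℝ × ℝ => k.2 * (1 - cdf₂ β f k.2)) (Ioc 0 β ×ˢ Icc 0 β) :=
    h₂.continuousOn_price.comp continuousOn_snd fun k hk => hk.2
  exact (continuousOn_const.mul (continuousOn_const.sub hfst)).add
    ((continuousOn_const.sub (continuousOn_const.div continuousOn_fst
      fun k hk => hk.1.1.ne')).mul hsnd)

theorem Post2BeatsPost1.exists_isBestPost2 (hb : 0 < b) (hf : IsJointDensity β f)
    (h₁ : IsMarginal β (cdf₁ β f) (density₁ f)) (h₂ : IsMarginal β (cdf₂ β f) (density₂ β f))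
    (h : Post2BeatsPost1 β b f) : ∃ κ₁ κ₂, IsBestPost2 β b f κ₁ κ₂ := by
  obtain ⟨M, k₁, k₂, hM, hbeat⟩ := h
  let D : Set (ℝ × ℝ) := {k | b ≤ k.1 ∧ k.1 ≤ k.2 ∧ k.2 ≤ β}
  -- The bound b ≤ κ₁ keeps the first price away from 0, where b/κ₁ is singular.
  have hsub : D ⊆ Ioc 0 β ×ˢ Icc 0 β := fun k hk =>
    ⟨⟨hb.trans_le hk.1, hk.2.1.trans hk.2.2⟩, (hb.le.trans hk.1).trans hk.2.1, hk.2.2⟩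
  have hD : IsCompact D := by
    have hcl : IsClosed D := (isClosed_le continuous_const continuous_fst).inter
      ((isClosed_le continuous_fst continuous_snd).inter
        (isClosed_le continuous_snd continuous_const))
    exact (isCompact_Icc.prod isCompact_Icc).of_isClosed_subset hcl
      (hsub.trans (prod_mono_left Ioc_subset_Icc_self))
  have hkD : (k₁, k₂) ∈ D := ⟨hM.1, hM.2.1, hM.2.2.1⟩
  obtain ⟨κ, hκ, hmax⟩ :=
    hD.exists_isMaxOn ⟨_, hkD⟩ ((continuousOn_post2Revenue (b := b) h₁ h₂).mono hsub)
  refine ⟨κ.1, κ.2, hκ.1, hκ.2.1, hκ.2.2, fun j₁ j₂ hj₁ hj₂ hj₃ =>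
    hmax (show (j₁, j₂) ∈ D from ⟨hj₁, hj₂, hj₃⟩), fun p hp => ?_⟩
  obtain ⟨N, hN⟩ := Mechanism.exists_isPost1 β hp
  have h3 := hbeat N p hN
  rw [hN.revenue_eq hf, hM.revenue_eq hf] at h3
  exact h3.trans_le (hmax hkD)

namespace IsBestPost2

/-- At κ₁ = b the revenue is that of POST-1 with price b. -/
theorem budget_lt (hb : 0 < b) (h : IsBestPost2 β b f κ₁ κ₂) : b < κ₁ := by
  refine lt_of_le_of_ne h.budget_le ?_
  rintro rfl
  have := h.beats b ⟨hb.le, le_rfl⟩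
  simp [post2Revenue, div_self hb.ne'] at this

/-- At κ₁ = β nothing is earned, no more than by POST-1 with price 0. -/
theorem lt_top (hb : 0 < b) (h₁ : IsMarginal β (cdf₁ β f) (density₁ f))
    (h₂ : IsMarginal β (cdf₂ β f) (density₂ β f)) (h : IsBestPost2 β b f κ₁ κ₂) : κ₁ < β := by
  refine lt_of_le_of_ne (h.le.trans h.le_top) ?_
  rintro rfl
  have e : κ₂ = κ₁ := le_antisymm h.le_top h.le
  have := h.beats 0 ⟨le_rfl, hb.le⟩
  simp [post2Revenue, e, h₁.top, h₂.top] at this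

/-- For fixed κ₁ > b the second price enters only through x(1 − F₂(x)) with a positive factor. Its
single peak, truncated by κ₂ ≥ κ₁, is the only maximizer. -/
theorem snd_eq_max (hb : 0 < b) (h₂ : IsMarginal β (cdf₂ β f) (density₂ β f))
    (hk : k ∈ Ioo 0 β) (hinc : ∀ t ∈ Ioo 0 k, 0 < 1 - cdf₂ β f t - t * density₂ β f t)
    (hdec : ∀ t ∈ Ioo k β, 1 - cdf₂ β f t - t * density₂ β f t < 0)
    (h : IsBestPost2 β b f κ₁ κ₂) : κ₂ = max κ₁ k := by
  have hbκ := h.budget_lt hb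
  have hκ : 0 < κ₁ := hb.trans hbκ
  have hr : 0 < 1 - b / κ₁ := sub_pos.2 ((div_lt_one hκ).2 hbκ)
  have hm : max κ₁ k ≤ β := max_le (h.le.trans h.le_top) hk.2.le
  have hmax := h.isMax κ₁ (max κ₁ k) h.budget_le (le_max_left _ _) hm
  have hle : max κ₁ k * (1 - cdf₂ β f (max κ₁ k)) ≤ κ₂ * (1 - cdf₂ β f κ₂) := by
    refine le_of_mul_le_mul_left ?_ hr
    unfold post2Revenue at hmax
    linarith
  rcases lt_trichotomy κ₂ (max κ₁ k) with hlt | heq | hlt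
  · have hk' : κ₂ < k := (lt_max_iff.1 hlt).resolve_left h.le.not_gt
    rw [max_eq_right (h.le.trans hk'.le)] at hle
    exact absurd hle (h₂.strictMonoOn_price hk.2.le hinc
      ⟨hκ.le.trans h.le, hk'.le⟩ ⟨hk.1.le, le_rfl⟩ hk').not_ge
  · exact heq
  · exact absurd hle (h₂.strictAntiOn_price hk.1.le hdec ⟨le_max_right _ _, hm⟩
      ⟨(le_max_right _ _).trans hlt.le, h.le_top⟩ hlt).not_ge

/-- First-order condition for the agent's price, when it is below the principal's price. -/
theorem foc_of_lt (hb : 0 < b) (h₁ : IsMarginal β (cdf₁ β f) (density₁ f))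
    (h : IsBestPost2 β b f κ₁ κ₂) (hlt : κ₁ < κ₂) :
    κ₁ ^ 2 * density₁ f κ₁ = κ₂ * (1 - cdf₂ β f κ₂) := by
  have hbκ := h.budget_lt hb
  have hκ : 0 < κ₁ := hb.trans hbκ
  have hd : HasDerivAt (fun x => post2Revenue β b f x κ₂)
      (b * -density₁ f κ₁ + -(b * -(κ₁ ^ 2)⁻¹) * (κ₂ * (1 - cdf₂ β f κ₂))) κ₁ :=
    (((h₁.hasDerivAt κ₁ ⟨hκ, hlt.trans_le h.le_top⟩).const_sub 1).const_mul b).add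
      ((((hasDerivAt_inv hκ.ne').const_mul b).const_sub 1).mul_const _)
  have hloc : IsLocalMax (fun x => post2Revenue β b f x κ₂) κ₁ := by
    filter_upwards [isOpen_Ioo.mem_nhds (show κ₁ ∈ Ioo b κ₂ from ⟨hbκ, hlt⟩)] with x hx
    exact h.isMax x κ₂ hx.1.le hx.2.le h.le_top
  have h0 := hloc.hasDerivAt_eq_zero hd
  field_simp at h0
  rw [mul_zero] at h0
  have := (mul_eq_zero.1 h0).resolve_left hb.ne'
  linarith

/-- First-order condition for a uniform price. -/
theorem foc_of_eq (hb : 0 < b) (h₁ : IsMarginal β (cdf₁ β f) (density₁ f))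
    (h₂ : IsMarginal β (cdf₂ β f) (density₂ β f)) (h : IsBestPost2 β b f κ κ) :
    κ * density₂ β f κ - (1 - cdf₂ β f κ) = b * (density₂ β f κ - density₁ f κ) := by
  have hbκ := h.budget_lt hb
  have hκ : 0 < κ := hb.trans hbκ
  have hκβ := h.lt_top hb h₁ h₂
  -- On the boundary κ₁ = κ₂ the perturbation moves both prices together, which is feasible in both
  -- directions.
  have hd : HasDerivAt (fun x => post2Revenue β b f x x)
      (b * -density₁ f κ + (-(b * -(κ ^ 2)⁻¹) * (κ * (1 - cdf₂ β f κ)) +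
        (1 - b * κ⁻¹) * (1 - cdf₂ β f κ - κ * density₂ β f κ))) κ :=
    (((h₁.hasDerivAt κ ⟨hκ, hκβ⟩).const_sub 1).const_mul b).add
      ((((hasDerivAt_inv hκ.ne').const_mul b).const_sub 1).mul (h₂.hasDerivAt_price ⟨hκ, hκβ⟩))
  have hloc : IsLocalMax (fun x => post2Revenue β b f x x) κ := by
    filter_upwards [isOpen_Ioo.mem_nhds (show κ ∈ Ioo b β from ⟨hbκ, hκβ⟩)] with x hx
    exact h.isMax x x hx.1.le le_rfl hx.2.le
  have h0 := hloc.hasDerivAt_eq_zero hd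
  have e : κ * (κ ^ 2)⁻¹ = κ⁻¹ := by field_simp
  have e' : κ * κ⁻¹ = 1 := mul_inv_cancel₀ hκ.ne'
  linear_combination -h0 + b * (1 - cdf₂ β f κ) * e + b * density₂ β f κ * e'

end IsBestPost2

theorem Mechanism.IsPost2.isOptimal {M : Mechanism β} (hβ : 0 < β) (hb : 0 < b)
    (hf : IsJointDensity β f)
    (h₁ : IsMarginal β (cdf₁ β f) (density₁ f)) (h₂ : IsMarginal β (cdf₂ β f) (density₂ β f))
    (hconc : ConcaveOn ℝ (Icc 0 β) fun x => x * (1 - cdf₁ β f x)) (hk : k ∈ Ioo 0 β)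
    (hinc : ∀ t ∈ Ioo 0 k, 0 < 1 - cdf₂ β f t - t * density₂ β f t)
    (hdec : ∀ t ∈ Ioo k β, 1 - cdf₂ β f t - t * density₂ β f t < 0)
    (hM : M.IsPost2 b κ₁ κ₂) (h : IsBestPost2 β b f κ₁ κ₂) : M.IsOptimal b f := by
  refine ⟨hM.ic hb (h.budget_lt hb), hM.ir hb, hM.hasRevenue hf, fun N hN hIR hrev => ?_⟩
  rw [hM.revenue_eq hf]
  rcases hN.revenue_le hβ hb hf h₁ h₂ hconc (Ioo_subset_Icc_self hk)
    (fun t ht => (hinc t ht).le) (fun t ht => (hdec t ht).le) hIR hrev with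
    ⟨κ, hκ, _, hle⟩ | ⟨k₁, k₂, hk₁, hk₂, hk₃, hle⟩
  · exact hle.trans (h.beats κ hκ).le
  · exact hle.trans (h.isMax k₁ k₂ hk₁ hk₂ hk₃)

/-- A best price pair is realized by an IC and IR mechanism, so an optimal POST-2 mechanism earns at
least as much and its own prices inherit maximality. -/
theorem Mechanism.IsPost2.isBestPost2 {M : Mechanism β} (hb : 0 < b) (hf : IsJointDensity β f)
    (hM : M.IsPost2 b κ₁ κ₂) (hopt : M.IsOptimal b f)
    (hex : ∃ k₁ k₂, IsBestPost2 β b f k₁ k₂) : IsBestPost2 β b f κ₁ κ₂ := by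
  obtain ⟨k₁, k₂, h⟩ := hex
  obtain ⟨N, hN⟩ := Mechanism.exists_isPost2 hb h.budget_le h.le h.le_top
  have hle := hopt.2.2.2 N (hN.ic hb (h.budget_lt hb)) (hN.ir hb) (hN.hasRevenue hf)
  rw [hN.revenue_eq hf, hM.revenue_eq hf] at hle
  exact ⟨hM.1, hM.2.1, hM.2.2.1, fun j₁ j₂ hj₁ hj₂ hj₃ => (h.isMax j₁ j₂ hj₁ hj₂ hj₃).trans hle,
    fun κ hκ => (h.beats κ hκ).trans_le hle⟩

end BudgetSale

/-! ### Uniform versus interior prices -/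

theorem mainTheorem4 (β b : ℝ) (hβ : 0 < β) (hb : 0 < b)
    (f : ℝ × ℝ → ℝ) (hf : IsJointDensity β f)
    (hf₁pos : ∀ x ∈ Set.Ioo 0 β, 0 < density₁ f x)
    (hf₂pos : ∀ x ∈ Set.Ioo 0 β, 0 < density₂ β f x)
    (hf₁diff : DifferentiableOn ℝ (density₁ f) (Set.Ioo 0 β))
    (hf₂diff : DifferentiableOn ℝ (density₂ β f) (Set.Ioo 0 β))
    (hMLRP : MLRP β f)
    (hconc : StrictConcaveOn ℝ (Set.Icc 0 β) (fun x => x * (1 - cdf₁ β f x)))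
    (hSC : SingleCrossing β f)
    (k₂ : ℝ) (hk₂ : k₂ ∈ Set.Icc 0 β)
    (hk₂max : IsMaxOn (fun x => x * (1 - cdf₂ β f x)) (Set.Icc 0 β) k₂)
    (hbeats : Post2BeatsPost1 β b f) :
    -- the ratio at `k₂` is at most one: uniform
    (density₁ f k₂ / density₂ β f k₂ ≤ 1 →
      (∃ (M : Mechanism β) (κ : ℝ), M.IsUniformPost2 b κ κ ∧ M.IsOptimal b f) ∧
      (∀ (M : Mechanism β) (κ₁ κ₂ : ℝ), M.IsPost2 b κ₁ κ₂ → M.IsOptimal b f →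
        M.IsUniformPost2 b κ₁ κ₂ ∧ k₂ ≤ κ₁ ∧
          κ₁ * density₂ β f κ₁ - (1 - cdf₂ β f κ₁)
            = b * (density₂ β f κ₁ - density₁ f κ₁))) ∧
    -- the ratio at `k₂` exceeds one: interior
    (1 < density₁ f k₂ / density₂ β f k₂ →
      (∃ (M : Mechanism β) (κ₁ κ₂ : ℝ), M.IsInteriorPost2 b κ₁ κ₂ ∧ M.IsOptimal b f) ∧
      (∀ (M : Mechanism β) (κ₁ κ₂ : ℝ), M.IsPost2 b κ₁ κ₂ → M.IsOptimal b f →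
        M.IsInteriorPost2 b κ₁ κ₂)) := by
  have h₁ := hf.isMarginal₁ hβ hf₁diff
  have h₂ := hf.isMarginal₂ hβ hf₂diff
  obtain ⟨hk, hinc, hzero, hdec⟩ := hSC.of_isMaxOn h₂ hf₂pos hk₂ hk₂max
  have hex := hbeats.exists_isBestPost2 hb hf h₁ h₂
  have hopt : ∀ {M : Mechanism β} {κ₁ κ₂}, M.IsPost2 b κ₁ κ₂ → IsBestPost2 β b f κ₁ κ₂ →
      M.IsOptimal b f := fun hM h =>
    hM.isOptimal hβ hb hf h₁ h₂ hconc.concaveOn hk hinc hdec h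
  have hsnd : ∀ {κ₁ κ₂}, IsBestPost2 β b f κ₁ κ₂ → κ₂ = max κ₁ k₂ := fun h =>
    h.snd_eq_max hb h₂ hk hinc hdec
  constructor
  · intro hratio
    have huniform : ∀ {κ₁ κ₂}, IsBestPost2 β b f κ₁ κ₂ → k₂ ≤ κ₁ ∧ κ₂ = κ₁ := by
      intro κ₁ κ₂ h
      have hle : k₂ ≤ κ₁ := by
        by_contra! hlt
        have e := hsnd h
        rw [max_eq_right hlt.le] at e
        subst e
        have hκ : 0 < κ₁ := hb.trans_le h.budget_le
        have hκm : κ₁ ∈ Ioo 0 β := ⟨hκ, hlt.trans hk.2⟩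
        -- With R₂(x) = x(1 − F₂(x)), the condition reads κ₁²f₁(κ₁) = R₂(k₂). But MLRP gives f₁ ≤ f₂
        -- at κ₁, and below the peak κ₁²f₂(κ₁) < R₂(κ₁) < R₂(k₂).
        have hfoc := h.foc_of_lt hb h₁ hlt
        have hlr := (hMLRP hκm hk hlt.le).trans hratio
        dsimp only at hlr
        rw [div_le_one (hf₂pos κ₁ hκm)] at hlr
        have h3 := mul_le_mul_of_nonneg_left hlr (sq_nonneg κ₁)
        have h4 := mul_pos hκ (hinc κ₁ ⟨hκ, hlt⟩)
        have h5 := h₂.strictMonoOn_price hk.2.le hinc ⟨hκ.le, hlt.le⟩ ⟨hk.1.le, le_rfl⟩ hlt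
        dsimp only at h5
        linarith
      exact ⟨hle, by rw [hsnd h, max_eq_left hle]⟩
    refine ⟨?_, fun M κ₁ κ₂ hM hMopt => ?_⟩
    · obtain ⟨κ₁, κ₂, h⟩ := hex
      obtain ⟨-, rfl⟩ := huniform h
      obtain ⟨M, hM⟩ := Mechanism.exists_isPost2 hb h.budget_le h.le h.le_top
      exact ⟨M, κ₂, ⟨hM, rfl⟩, hopt hM h⟩
    · have h := hM.isBestPost2 hb hf hMopt hex
      obtain ⟨hle, rfl⟩ := huniform h
      exact ⟨⟨hM, rfl⟩, hle, h.foc_of_eq hb h₁ h₂⟩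
  · intro hratio
    have hinterior : ∀ {κ₁ κ₂}, IsBestPost2 β b f κ₁ κ₂ → b < κ₁ ∧ κ₁ < κ₂ ∧ κ₂ < β := by
      intro κ₁ κ₂ h
      have hlt : κ₁ < k₂ := by
        by_contra! hle
        have e := hsnd h
        rw [max_eq_left hle] at e
        subst e
        have hκm : κ₂ ∈ Ioo 0 β := ⟨hk.1.trans_le hle, h.lt_top hb h₁ h₂⟩
        -- At a uniform price no smaller than the peak the left side is nonnegative, while MLRP
        -- gives f₁ > f₂ there and makes the right side negative.
        have hfoc := h.foc_of_eq hb h₁ h₂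
        have hlr := hratio.trans_le (hMLRP hk hκm hle)
        rw [one_lt_div (hf₂pos κ₂ hκm)] at hlr
        have h3 := mul_pos hb (sub_pos.2 hlr)
        have h4 : 1 - cdf₂ β f κ₂ - κ₂ * density₂ β f κ₂ ≤ 0 := by
          rcases hle.eq_or_lt with rfl | hlt
          · exact hzero.le
          · exact (hdec κ₂ ⟨hlt, hκm.2⟩).le
        linarith
      rw [hsnd h, max_eq_right hlt.le]
      exact ⟨h.budget_lt hb, hlt, hk.2⟩
    refine ⟨?_, fun M κ₁ κ₂ hM hMopt => ⟨hM, hinterior (hM.isBestPost2 hb hf hMopt hex)⟩⟩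
    obtain ⟨κ₁, κ₂, h⟩ := hex
    obtain ⟨M, hM⟩ := Mechanism.exists_isPost2 hb h.budget_le h.le h.le_top
    exact ⟨M, κ₁, κ₂, ⟨hM, hinterior h⟩, hopt hM h⟩
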